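/- **Setting.** There are $n$ users and $T$ resources. At time $t=1,\dots,T$ resource $t$ arrives independently with probability $p_t\in[0,1]$; on arrival it may be irrevocably allocated to at most $c_t\in\mathbb{N}$ users that are still available (each user is allocated to at most one resource), and allocating user $i$ to resource $t$ yields value $v_{i,t}\ge 0$ (all allocations succeed). Let $\mathrm{OPT}_{\mathrm{on}}=\mathrm{OPT}_{\mathrm{on}}(1,[n])$ be the optimal expected total value of an online algorithm, i.e. $\mathrm{OPT}_{\mathrm{on}}(T+1,J)=0$ and $\mathrm{OPT}_{\mathrm{on}}(t,J)=(1-p_t)\,\mathrm{OPT}_{\mathrm{on}}(t+1,J)+p_t\max_{J'\subseteq J,\,|J'|\le c_t}\big(\sum_{i\in J'}v_{i,t}+\mathrm{OPT}_{\mathrm{on}}(t+1,J\setminus J')\big)$. Let $x=(x_{i,t})$ be an optimal solution of the linear program $$\mathrm{OPT}(\mathrm{LP})=\max\sum_{i,t}x_{i,t}v_{i,t}\quad\text{s.t.}\quad \sum_i x_{i,t}\le p_tc_t\ \ \forall t,\qquad 0\le x_{i,t}\le p_t\Big(1-\sum_{t'<t}x_{i,t'}\Big)\ \ \forall i,t .$$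 Write $y_{i,t}=\sum_{t'<t}x_{i,t'}$, and let $\mathsf{PS}(z_1,\dots,z_n)$ denote the random subset of $[n]$ produced by pivotal sampling (dependent rounding) with marginals $z_i$: as long as two coordinates lie in $(0,1)$, take the first two of them, with values $a,b$, put $d=\min(1-a,b)$, $d'=\min(a,1-b)$, and replace $(a,b)$ by $(a+d,b-d)$ with probability $d'/(d+d')$ and by $(a-d',b+d')$ otherwise; a single remaining fractional coordinate is rounded to $1$ with probability equal to its value and to $0$ otherwise; output the coordinates equal to $1$. **The sampling-based algorithm.** Let $0<\varepsilon<0.0115$ and $\kappa=0.0115-\varepsilon$. Given a table of estimates $\hat\sigma=(\hat\sigma_{i,t})$, the algorithm does the following at each time $t$ at which resource $t$ arrives. (1) Draw $\mathsf{FP}_t=\mathsf{PS}((x_{i,t}/p_t)_i)$ and allocate each available $i\in\mathsf{FP}_t$ to $t$ independently with probability $\alpha_{i,t}=\min\big(1,\frac{0.5+\kappa}{1-(0.5+\kappa)y_{i,t}}\big)$; let $A_t$ be the number of users allocated in this way. (2) Draw $\mathsf{SP}_t=\mathsf{PS}\big(((1-\frac{A_t}{c_t})\frac{x_{i,t}}{p_t})_i\big)$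 and allocate each $i\in\mathsf{SP}_t$ with $\alpha_{i,t}=1$ that is available and still unallocated to $t$ independently with probability $\hat\beta_{i,t}=\min\big(1,\frac{(0.5+\kappa)y_{i,t}-(0.5-\kappa)}{\hat\sigma_{i,t}}\big)$. Let $\mathcal{A}_1$ and $\mathcal{A}_2$ be the sets of pairs $(i,t)$ such that $i$ is allocated to $t$ in part (1) and in part (2), respectively. The estimates are generated successively for $t=1,\dots,T$: given $(\hat\sigma_{i,t'})_{i,\,t'<t}$, the value $\hat\sigma_{i,t}$ is the average of $$N=\Big\lceil 50\,nT\,\big(\tfrac{\varepsilon}{400T}\big)^{-2}\kappa^{-2}\Big\rceil$$ independent simulations, conditioned on the arrival of $t$ and using the previously computed estimates, of $\mathbb{1}[i\text{ available and unallocated after part (1) at time }t]\cdot(1-\frac{A_t}{c_t})$. Below, $\Pr[\,\cdot\mid\hat\sigma]$ and $\mathbb{E}[\,\cdot\mid\hat\sigma]$ refer to the arrivals and the coins of a run of the algorithm with fixed estimates $\hat\sigma$, and "with probability" refers to the random draw of $\hat\sigma$. **Statement.** (a) For every $t\in\{1,\dots,T\}$, with probability at least $1-2nt\cdot\exp(-100nT)$,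 we have for all $t'\le t$ and all users $i$ $$\Pr[(i,t')\in\mathcal{A}_1\mid\hat\sigma]+\Pr[(i,t')\in\mathcal{A}_2\mid\hat\sigma]\in\Big[\big(0.5+\kappa-\tfrac{\varepsilon t'}{T}\big)x_{i,t'},\ \big(0.5+\kappa+\tfrac{\varepsilon t'}{T}\big)x_{i,t'}\Big].$$ (b) Consequently, with probability at least $1-2nT\cdot\exp(-100nT)$, the expected social welfare $\mathbb{E}[\mathrm{SW}\mid\hat\sigma]$ of the sampling-based algorithm is at least $(0.5115-2\varepsilon)\cdot\mathrm{OPT}(\mathrm{LP})$ and at least $(0.5115-2\varepsilon)\cdot\mathrm{OPT}_{\mathrm{on}}$. -/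

import Mathlib

noncomputable section

namespace OnlineAllocation

/-! ## Elementary random experiments -/

/-- A real number truncated to `[0, 1]`. (All probabilities used below lie in `[0, 1]` already.) -/
def clamp (q : ℝ) : ℝ := max 0 (min q 1)

theorem clamp_nonneg (q : ℝ) : 0 ≤ clamp q := le_max_left _ _

theorem clamp_le_one (q : ℝ) : clamp q ≤ 1 := max_le zero_le_one (min_le_right _ _)

theorem ofReal_clamp_add (q : ℝ) :
    ENNReal.ofReal (clamp q) + ENNReal.ofReal (1 - clamp q) = 1 := by
  rw [← ENNReal.ofReal_add (clamp_nonneg q) (sub_nonneg.2 (clamp_le_one q))]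
  simp

/-- A coin that shows `true` with probability `q`. -/
def coin (q : ℝ) : PMF Bool :=
  PMF.ofFintype
    (fun b => if b then ENNReal.ofReal (clamp q) else ENNReal.ofReal (1 - clamp q))
    (by simpa using ofReal_clamp_add q)

/-- The random set of users that contains each user `i` independently with probability `a i`. -/
def independentSubset {n : ℕ} (a : Fin n → ℝ) : PMF (Finset (Fin n)) :=
  PMF.ofFintype
    (fun S => (∏ i ∈ S, ENNReal.ofReal (clamp (a i))) *
      ∏ i ∈ Finset.univ \ S, ENNReal.ofReal (1 - clamp (a i)))
    (by
      have h := Finset.prod_add (fun i => ENNReal.ofReal (clamp (a i)))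
        (fun i => ENNReal.ofReal (1 - clamp (a i))) (Finset.univ : Finset (Fin n))
      rw [Finset.powerset_univ] at h
      rw [← h]
      simp [ofReal_clamp_add])

/-- The probability of an event, as a real number. -/
def prob {Ω : Type} (μ : PMF Ω) (E : Set Ω) : ℝ := (μ.toOuterMeasure E).toReal

/-- The expectation of a function on a finite sample space. -/
def expect {Ω : Type} [Fintype Ω] (μ : PMF Ω) (f : Ω → ℝ) : ℝ := ∑ ω, (μ ω).toReal * f ω

/-- The law of the sum of `N` independent samples from `μ`. -/
def iidSum (μ : PMF ℝ) : ℕ → PMF ℝ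
  | 0 => PMF.pure 0
  | N + 1 => (iidSum μ N).bind fun s => μ.map fun v => s + v

/-- The law of the average of `N` independent samples from `μ`. -/
def empiricalAverage (μ : PMF ℝ) (N : ℕ) : PMF ℝ := (iidSum μ N).map fun s => s / N

/-! ## Pivotal sampling (dependent rounding) -/

/-- The coordinates that are not yet rounded, in increasing order. -/
def fractional {n : ℕ} (x : Fin n → ℝ) : List (Fin n) :=
  (Finset.univ.filter fun i => 0 < x i ∧ x i < 1).sort

/-- The pivot operation on coordinates `i`, `j` with values `a`, `b`: with `d = min (1 - a) b` and
`d' = min a (1 - b)`, replace `(a, b)` by `(a + d, b - d)` with probability `d' / (d + d')` and by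
`(a - d', b + d')` otherwise. -/
def pivot {n : ℕ} (x : Fin n → ℝ) (i j : Fin n) : PMF (Fin n → ℝ) :=
  let d := min (1 - x i) (x j)
  let d' := min (x i) (1 - x j)
  (coin (d' / (d + d'))).map fun b =>
    if b then Function.update (Function.update x i (x i + d)) j (x j - d)
    else Function.update (Function.update x i (x i - d')) j (x j + d')

/-- One step of pivotal sampling: pivot on two fractional coordinates; if only one coordinate is
fractional, round it to `1` with probability equal to its value and to `0` otherwise. -/
def pivotStep {n : ℕ} (x : Fin n → ℝ) : PMF (Fin n → ℝ) :=
  match fractional x with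
  | [] => PMF.pure x
  | [i] => (coin (x i)).map fun b => Function.update x i (if b then 1 else 0)
  | i :: j :: _ => pivot x i j

/-- `k` steps of pivotal sampling. -/
def pivotSteps {n : ℕ} : ℕ → (Fin n → ℝ) → PMF (Fin n → ℝ)
  | 0, x => PMF.pure x
  | k + 1, x => (pivotStep x).bind (pivotSteps k)

/-- Pivotal sampling `PS(x)`. Every step rounds at least one further coordinate, so after `n` steps
all coordinates are `0` or `1`; the sampled set consists of the coordinates rounded to `1`. -/
def pivotalSampling {n : ℕ} (x : Fin n → ℝ) : PMF (Finset (Fin n)) :=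
  (pivotSteps n x).map fun y => Finset.univ.filter fun i => y i = 1

/-! ## The allocation problem, the LP relaxation, the optimum online algorithm -/

/-- An instance with `n` users and `T` resources: resource `t` arrives independently with
probability `p t`, it can serve up to `c t` users, and `v i t` is the value of serving user `i` by
resource `t`. -/
structure Instance (n T : ℕ) where
  p : Fin T → ℝ
  c : Fin T → ℕ
  v : Fin n → Fin T → ℝ
  p_nonneg : ∀ t, 0 ≤ p t
  p_le_one : ∀ t, p t ≤ 1
  v_nonneg : ∀ i t, 0 ≤ v i t

variable {n T : ℕ}

/-- `y i t = ∑_{t' < t} x i t'`. -/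
def partialSum (x : Fin n → Fin T → ℝ) (i : Fin n) (t : Fin T) : ℝ := ∑ t' ∈ Finset.Iio t, x i t'

/-- Feasibility for the LP relaxation of the optimum online algorithm. -/
def LPFeasible (I : Instance n T) (x : Fin n → Fin T → ℝ) : Prop :=
  (∀ t, ∑ i, x i t ≤ I.p t * I.c t) ∧
    ∀ i t, 0 ≤ x i t ∧ x i t ≤ I.p t * (1 - partialSum x i t)

/-- The objective of the LP. -/
def lpValue (I : Instance n T) (x : Fin n → Fin T → ℝ) : ℝ := ∑ i, ∑ t, x i t * I.v i t

/-- `x` is an optimal solution of the LP. -/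
def LPOptimal (I : Instance n T) (x : Fin n → Fin T → ℝ) : Prop :=
  LPFeasible I x ∧ ∀ x', LPFeasible I x' → lpValue I x' ≤ lpValue I x

theorem exists_served (c : ℕ) (J : Finset (Fin n)) :
    (J.powerset.filter fun J' => J'.card ≤ c).Nonempty :=
  ⟨∅, by simp⟩

/-- The Bellman recursion: the largest expected welfare that an online algorithm can achieve from
the resources `t, t + 1, …` (counted from `0`) if the users in `J` are available. -/
def optOnlineFrom (I : Instance n T) (t : ℕ) (J : Finset (Fin n)) : ℝ :=
  if h : t < T then
    (1 - I.p ⟨t, h⟩) * optOnlineFrom I (t + 1) J +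
      I.p ⟨t, h⟩ *
        (J.powerset.filter fun J' => J'.card ≤ I.c ⟨t, h⟩).sup' (exists_served _ J)
          (fun J' => ∑ i ∈ J', I.v i ⟨t, h⟩ + optOnlineFrom I (t + 1) (J \ J'))
  else 0
termination_by T - t

/-- The expected welfare of the optimum online algorithm. -/
def optOnline (I : Instance n T) : ℝ := optOnlineFrom I 0 Finset.univ

/-! ## The two-proposal algorithm, run with given estimates -/

/-- The record of a run: the set `𝒜₁` of pairs `(i, t)` such that `i` was allocated to `t` in the
first proposal of `t`, and the set `𝒜₂` of those allocated in the second proposal of `t`. -/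
abbrev Record (n T : ℕ) : Type := Finset (Fin n × Fin T) × Finset (Fin n × Fin T)

/-- The users that are not allocated to any resource so far. -/
def free (s : Record n T) : Finset (Fin n) :=
  Finset.univ.filter fun i => ∀ t, (i, t) ∉ s.1 ∧ (i, t) ∉ s.2

/-- The parameter `κ` of the sampling-based algorithm. -/
def kappa (ε : ℝ) : ℝ := 0.0115 - ε

/-- The probability with which an available user in the first proposal set is allocated. -/
def alpha (κ : ℝ) (x : Fin n → Fin T → ℝ) (i : Fin n) (t : Fin T) : ℝ :=
  min 1 ((0.5 + κ) / (1 - (0.5 + κ) * partialSum x i t))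

/-- The probability `min (1, ((0.5 + κ) y - (0.5 - κ)) / σ)` with which an available user in the
second proposal set is allocated, given the estimate `σ`; a positive number divided by `0` counts
as infinite. -/
def betaHat (κ : ℝ) (x : Fin n → Fin T → ℝ) (i : Fin n) (t : Fin T) (σ : ℝ) : ℝ :=
  let a := (0.5 + κ) * partialSum x i t - (0.5 - κ)
  if σ = 0 ∧ 0 < a then 1 else min 1 (a / σ)

/-- The users allocated to `t` in its first proposal, given that `t` arrives. -/
def firstProposal (I : Instance n T) (κ : ℝ) (x : Fin n → Fin T → ℝ) (t : Fin T)
    (s : Record n T) : PMF (Finset (Fin n)) :=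
  (pivotalSampling fun i => x i t / I.p t).bind fun FP =>
    (independentSubset fun i => alpha κ x i t).map fun C => FP ∩ C ∩ free s

/-- The users allocated to `t` in its second proposal, given that `t` arrives and that `A₁` is the
set of users allocated to it in the first proposal. -/
def secondProposal (I : Instance n T) (κ : ℝ) (x σ : Fin n → Fin T → ℝ) (t : Fin T)
    (s : Record n T) (A₁ : Finset (Fin n)) : PMF (Finset (Fin n)) :=
  (pivotalSampling fun i => (1 - (A₁.card : ℝ) / I.c t) * (x i t / I.p t)).bind fun SP =>
    (independentSubset fun i => betaHat κ x i t (σ i t)).map fun C =>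
      (SP ∩ C ∩ (free s \ A₁)).filter fun i => alpha κ x i t = 1

/-- The step of the algorithm for resource `t`. -/
def step (I : Instance n T) (κ : ℝ) (x σ : Fin n → Fin T → ℝ) (t : Fin T) (s : Record n T) :
    PMF (Record n T) :=
  (coin (I.p t)).bind fun arrives =>
    if arrives then
      (firstProposal I κ x t s).bind fun A₁ =>
        (secondProposal I κ x σ t s A₁).map fun A₂ =>
          (s.1 ∪ A₁ ×ˢ {t}, s.2 ∪ A₂ ×ˢ {t})
    else PMF.pure s

/-- The law of the record just before resource `k` (counted from `0`), for the algorithm that uses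
the estimates `σ`. It depends only on the estimates for resources before `k`. -/
def runUpTo (I : Instance n T) (κ : ℝ) (x σ : Fin n → Fin T → ℝ) : ℕ → PMF (Record n T)
  | 0 => PMF.pure (∅, ∅)
  | k + 1 => (runUpTo I κ x σ k).bind fun s =>
      if h : k < T then step I κ x σ ⟨k, h⟩ s else PMF.pure s

/-- The law of the record of a complete run of the algorithm that uses the estimates `σ`. -/
def run (I : Instance n T) (κ : ℝ) (x σ : Fin n → Fin T → ℝ) : PMF (Record n T) :=
  runUpTo I κ x σ T

/-- The social welfare of a run. -/
def welfare (I : Instance n T) (s : Record n T) : ℝ := ∑ e ∈ s.1 ∪ s.2, I.v e.1 e.2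

/-! ## The estimates -/

/-- One simulation for the pair `(i, t)`: the law, given that `t` arrives, of
`𝟙[i available and unallocated after the first proposal of t] * (1 - A_t / c_t)`, where `A_t` is
the number of users allocated in the first proposal of `t` and the resources before `t` are
processed with the estimates `σ`. (The arrival of `t` is independent of the past.) -/
def simulation (I : Instance n T) (κ : ℝ) (x σ : Fin n → Fin T → ℝ) (i : Fin n) (t : Fin T) :
    PMF ℝ :=
  (runUpTo I κ x σ t).bind fun s =>
    (firstProposal I κ x t s).map fun A₁ =>
      if i ∈ free s \ A₁ then 1 - (A₁.card : ℝ) / I.c t else 0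

/-- The number `N = 50 n T (ε / (400 T))⁻² κ⁻²` of simulations for each pair, rounded up. -/
def numSimulations (n T : ℕ) (ε : ℝ) : ℕ :=
  ⌈50 * n * T * ((ε / (400 * T)) ^ 2)⁻¹ * (kappa ε ^ 2)⁻¹⌉₊

/-- Draw the estimates of all users for resource `t`, independently given the estimates `σ` for the
earlier resources, and enter them into the table. -/
def drawEstimates (I : Instance n T) (ε : ℝ) (x : Fin n → Fin T → ℝ) (t : Fin T)
    (σ : Fin n → Fin T → ℝ) : PMF (Fin n → Fin T → ℝ) :=
  (List.finRange n).foldlM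
    (fun σ' i =>
      (empiricalAverage (simulation I (kappa ε) x σ i t) (numSimulations n T ε)).map fun v =>
        Function.update σ' i (Function.update (σ' i) t v))
    σ

/-- The law of the table of estimates for the first `k` resources (all other entries are `0`). -/
def estimatesUpTo (I : Instance n T) (ε : ℝ) (x : Fin n → Fin T → ℝ) :
    ℕ → PMF (Fin n → Fin T → ℝ)
  | 0 => PMF.pure fun _ _ => 0
  | k + 1 => (estimatesUpTo I ε x k).bind fun σ =>
      if h : k < T then drawEstimates I ε x ⟨k, h⟩ σ else PMF.pure σ

/-- The law of the table of all estimates computed by the sampling-based algorithm. -/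
def estimates (I : Instance n T) (ε : ℝ) (x : Fin n → Fin T → ℝ) : PMF (Fin n → Fin T → ℝ) :=
  estimatesUpTo I ε x T

/-- Given the estimates `σ`, the probability that the sampling-based algorithm allocates `i` to `t`,
that is, `Pr[(i, t) ∈ 𝒜₁] + Pr[(i, t) ∈ 𝒜₂]`. -/
def allocProb (I : Instance n T) (ε : ℝ) (x σ : Fin n → Fin T → ℝ) (i : Fin n) (t : Fin T) : ℝ :=
  prob (run I (kappa ε) x σ) {s | (i, t) ∈ s.1} + prob (run I (kappa ε) x σ) {s | (i, t) ∈ s.2}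

/-- Given the estimates `σ`, the expected social welfare of the sampling-based algorithm. -/
def expectedWelfare (I : Instance n T) (ε : ℝ) (x σ : Fin n → Fin T → ℝ) : ℝ :=
  expect (run I (kappa ε) x σ) (welfare I)

end OnlineAllocation

end

noncomputable section

namespace OnlineAllocation

/-! ## Calculus of expectations on finite sample spaces -/

section Expect

variable {α β Ω : Type}

/-! Write θ = 0.5 + κ = 0.5115 − ε and y = y_{i,t}. With exact estimates every pair would be
allocated with probability exactly θ·x_{i,t}. Indeed a user is free iff it was not allocated before,
so i would be free at t with probability 1 − θy. If α < 1, the first proposal yields x·α·(1 − θy) =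
θx and the second is switched off. If α = 1, the first yields x(1 − θy) and the second supplies the
missing x·a, where a = θy − (0.5 − κ).

If all estimates are within ε/T of their means, strong induction on t (`abs_allocation_sub_le`)
controls the drift: past errors shift the probability of being free by at most (εt/T)·y (resources
counted from 0), and the second proposal adds at most one more ε/T, provided that a/σ̂ ≤ 1.

That proviso is the crux: the estimated mean must stay well above a ≤ 0.023. The danger is positive
correlation between the availability of i and that of the users who use up the capacity. Negative
correlation of pivotal sampling bounds the probability that i and j are both free
(`jointFreeProb_le`). This gives the lower bound of `le_simulationMean`, which is at least 0.07
because α = 1 forces y ≥ 0.955.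

Accuracy of the estimates is a Chernoff bound plus a union bound (`toOuterMeasure_estimates_le`).
For the welfare, sum over pairs; the online optimum is at most the LP because mixing the optimal
futures gives an LP solution of the same value (`exists_lp_solution_from`). -/

theorem toReal_sum_one [Fintype α] (μ : PMF α) : ∑ a, (μ a).toReal = 1 := by
  rw [← ENNReal.toReal_sum fun a _ => μ.apply_ne_top a, ← tsum_fintype (L := .unconditional α),
    μ.tsum_coe, ENNReal.toReal_one]

theorem expect_bind [Fintype α] [Fintype β] (μ : PMF α) (f : α → PMF β) (g : β → ℝ) :
    expect (μ.bind f) g = expect μ fun a => expect (f a) g := by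
  unfold expect
  simp_rw [PMF.bind_apply, tsum_fintype, Finset.mul_sum]
  rw [Finset.sum_comm]
  refine Finset.sum_congr rfl fun b _ => ?_
  rw [ENNReal.toReal_sum fun a _ => ENNReal.mul_ne_top (μ.apply_ne_top a) ((f a).apply_ne_top b),
    Finset.sum_mul]
  exact Finset.sum_congr rfl fun a _ => by rw [ENNReal.toReal_mul, mul_assoc]

theorem expect_pure [Fintype α] (a : α) (g : α → ℝ) : expect (PMF.pure a) g = g a := by
  classical
  unfold expect
  rw [Finset.sum_eq_single a]
  · simp
  · intro b _ hb
    simp [PMF.pure_apply, hb]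
  · simp

theorem expect_map [Fintype α] [Fintype β] (μ : PMF α) (f : α → β) (g : β → ℝ) :
    expect (μ.map f) g = expect μ fun a => g (f a) := by
  rw [← PMF.bind_pure_comp, expect_bind]
  simp [expect_pure]

theorem expect_const [Fintype α] (μ : PMF α) (r : ℝ) : expect μ (fun _ => r) = r := by
  unfold expect
  rw [← Finset.sum_mul, toReal_sum_one, one_mul]

theorem expect_add [Fintype α] (μ : PMF α) (f g : α → ℝ) :
    expect μ (fun a => f a + g a) = expect μ f + expect μ g := by
  simp [expect, mul_add, Finset.sum_add_distrib]

theorem expect_sub [Fintype α] (μ : PMF α) (f g : α → ℝ) :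
    expect μ (fun a => f a - g a) = expect μ f - expect μ g := by
  simp [expect, mul_sub, Finset.sum_sub_distrib]

theorem expect_const_mul [Fintype α] (μ : PMF α) (r : ℝ) (f : α → ℝ) :
    expect μ (fun a => r * f a) = r * expect μ f := by
  simp only [expect, Finset.mul_sum]
  exact Finset.sum_congr rfl fun a _ => by ring

theorem expect_mul_const [Fintype α] (μ : PMF α) (f : α → ℝ) (r : ℝ) :
    expect μ (fun a => f a * r) = expect μ f * r := by
  simp only [mul_comm _ r, expect_const_mul]

theorem expect_sum [Fintype α] {ι : Type} (s : Finset ι) (μ : PMF α) (f : ι → α → ℝ) :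
    expect μ (fun a => ∑ i ∈ s, f i a) = ∑ i ∈ s, expect μ (f i) := by
  simp only [expect, Finset.mul_sum]
  rw [Finset.sum_comm]

theorem expect_congr [Fintype α] {μ : PMF α} {f g : α → ℝ} (h : ∀ a ∈ μ.support, f a = g a) :
    expect μ f = expect μ g := by
  refine Finset.sum_congr rfl fun a _ => ?_
  by_cases ha : μ a = 0
  · simp [ha]
  · rw [h a ((μ.mem_support_iff a).2 ha)]

theorem expect_mono [Fintype α] {μ : PMF α} {f g : α → ℝ} (h : ∀ a ∈ μ.support, f a ≤ g a) :
    expect μ f ≤ expect μ g := by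
  refine Finset.sum_le_sum fun a _ => ?_
  by_cases ha : μ a = 0
  · simp [ha]
  · exact mul_le_mul_of_nonneg_left (h a ((μ.mem_support_iff a).2 ha)) ENNReal.toReal_nonneg

theorem expect_nonneg [Fintype α] {μ : PMF α} {f : α → ℝ} (h : ∀ a ∈ μ.support, 0 ≤ f a) :
    0 ≤ expect μ f := by
  simpa [expect_const] using expect_mono (f := fun _ => (0 : ℝ)) h

theorem clamp_of_mem {q : ℝ} (h₀ : 0 ≤ q) (h₁ : q ≤ 1) : clamp q = q := by
  simp [clamp, h₀, h₁]

theorem expect_coin {q : ℝ} (h₀ : 0 ≤ q) (h₁ : q ≤ 1) (f : Bool → ℝ) :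
    expect (coin q) f = q * f true + (1 - q) * f false := by
  simp [expect, coin, clamp_of_mem h₀ h₁, h₀, h₁]

theorem prob_pure (a : α) (S : Set α) [Decidable (a ∈ S)] :
    prob (PMF.pure a) S = if a ∈ S then 1 else 0 := by
  classical
  unfold prob
  rw [PMF.toOuterMeasure_pure_apply]
  split_ifs <;> simp

theorem prob_map (μ : PMF α) (f : α → β) (S : Set β) : prob (μ.map f) S = prob μ (f ⁻¹' S) := by
  unfold prob
  rw [PMF.toOuterMeasure_map_apply]

theorem toOuterMeasure_le_one (μ : PMF α) (S : Set α) : μ.toOuterMeasure S ≤ 1 := by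
  rw [PMF.toOuterMeasure_apply, ← μ.tsum_coe]
  exact ENNReal.tsum_le_tsum fun a => Set.indicator_le_self' (by simp) a

theorem prob_bind [Fintype α] (μ : PMF α) (f : α → PMF β) (S : Set β) :
    prob (μ.bind f) S = expect μ fun a => prob (f a) S := by
  unfold prob expect
  rw [PMF.toOuterMeasure_bind_apply, tsum_fintype, ENNReal.toReal_sum]
  · simp [ENNReal.toReal_mul]
  · exact fun a _ => ENNReal.mul_ne_top (μ.apply_ne_top a)
      (ne_top_of_le_ne_top ENNReal.one_ne_top (toOuterMeasure_le_one _ _))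

theorem prob_setOf [Fintype α] (μ : PMF α) (P : α → Prop) [DecidablePred P] :
    prob μ {a | P a} = expect μ fun a => if P a then 1 else 0 := by
  classical
  conv_lhs => rw [← μ.bind_pure]
  rw [prob_bind]
  simp only [prob_pure, Set.mem_ofPred_eq]

theorem toOuterMeasure_add_compl (μ : PMF α) (S : Set α) :
    μ.toOuterMeasure S + μ.toOuterMeasure Sᶜ = 1 := by
  rw [PMF.toOuterMeasure_apply, PMF.toOuterMeasure_apply, ← ENNReal.tsum_add, ← μ.tsum_coe]
  exact tsum_congr fun a => by
    by_cases h : a ∈ S <;> simp [h]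

end Expect

/-! ## Independent subsets -/

theorem expect_independentSubset {n : ℕ} (b : Fin n → ℝ) (R : Finset (Fin n)) :
    expect (independentSubset b) (fun C => if R ⊆ C then 1 else 0) = ∏ i ∈ R, clamp (b i) := by
  set a := fun i => clamp (b i) with ha
  -- Expanding the product over subsets weights each set by its probability; replacing 1 - a i by 0
  -- on R kills exactly the sets that miss an element of R.
  have key := Finset.prod_add a (fun i => if i ∈ R then 0 else 1 - a i)
    (Finset.univ : Finset (Fin n))
  rw [Finset.powerset_univ] at key
  have h : ∏ i, (a i + if i ∈ R then 0 else 1 - a i) = ∏ i ∈ R, a i := by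
    rw [← Finset.prod_subset (Finset.subset_univ R)]
    · exact Finset.prod_congr rfl fun i hi => by simp [hi]
    · intro i _ hi
      simp [hi]
  rw [← h, key]
  refine Finset.sum_congr rfl fun S _ => ?_
  have hS : (independentSubset b S).toReal = (∏ i ∈ S, a i) * ∏ i ∈ Finset.univ \ S, (1 - a i) := by
    simp only [independentSubset, PMF.ofFintype_apply, ENNReal.toReal_mul, ENNReal.toReal_prod]
    congr 1 <;> refine Finset.prod_congr rfl fun i _ => ?_
    · rw [ENNReal.toReal_ofReal (clamp_nonneg _)]
    · rw [ENNReal.toReal_ofReal (sub_nonneg.2 (clamp_le_one _))]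
  rw [hS, mul_assoc]
  congr 1
  beta_reduce
  split_ifs with hR
  · rw [mul_one]
    refine Finset.prod_congr rfl fun i hi => ?_
    rw [if_neg fun hi' => (Finset.mem_sdiff.1 hi).2 (hR hi')]
  · obtain ⟨i, hi, hi'⟩ := Finset.not_subset.1 hR
    rw [mul_zero, Finset.prod_eq_zero (i := i)]
    · simp [hi']
    · simp [hi]

/-! ## Pivotal sampling -/

section Pivotal

variable {n : ℕ}

/-- The set of coordinates that are not yet rounded. -/
def fracSet (x : Fin n → ℝ) : Finset (Fin n) := Finset.univ.filter fun i => 0 < x i ∧ x i < 1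

theorem mem_fracSet {x : Fin n → ℝ} {i : Fin n} : i ∈ fracSet x ↔ 0 < x i ∧ x i < 1 := by
  simp [fracSet]

theorem mem_fractional {x : Fin n → ℝ} {i : Fin n} : i ∈ fractional x ↔ 0 < x i ∧ x i < 1 := by
  simp [fractional]

/-- A random mean-preserving move of the point `x` of the unit cube along a line, to a point with
fewer fractional coordinates; no two coordinates move in the same direction, and an integral upper
bound on the sum of the coordinates is preserved. -/
structure IsRoundingMove (x : Fin n → ℝ) (q : ℝ) (δ : Bool → ℝ) (u : Fin n → ℝ) : Prop where
  nonneg : 0 ≤ q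
  le_one : q ≤ 1
  mean : q * δ true + (1 - q) * δ false = 0
  opposite : ∀ i j, i ≠ j → u i * u j ≤ 0
  mem : ∀ b k, x k + δ b * u k ∈ Set.Icc (0 : ℝ) 1
  card_lt : ∀ b, (fracSet fun k => x k + δ b * u k).card < (fracSet x).card
  sum_le : ∀ b (c : ℕ), ∑ k, x k ≤ c → ∑ k, (x k + δ b * u k) ≤ c

theorem eq_zero_or_one {r : ℝ} (h : r ∈ Set.Icc (0 : ℝ) 1) (h' : ¬(0 < r ∧ r < 1)) :
    r = 0 ∨ r = 1 := by
  by_contra! hc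
  exact h' ⟨lt_of_le_of_ne h.1 (Ne.symm hc.1), lt_of_le_of_ne h.2 hc.2⟩

theorem isRoundingMove_single {x : Fin n → ℝ} (hx : ∀ k, x k ∈ Set.Icc (0 : ℝ) 1) {i : Fin n}
    (hi : ∀ k, (0 < x k ∧ x k < 1) ↔ k = i) :
    IsRoundingMove x (x i) (fun b => if b then 1 - x i else -x i) (Pi.single i 1) where
  nonneg := (hx i).1
  le_one := (hx i).2
  mean := by simp only [if_true, Bool.false_eq_true, if_false]; ring
  opposite := fun k l hkl => by
    by_cases hk : k = i
    · subst hk; simp [Pi.single_eq_of_ne hkl.symm]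
    · simp [Pi.single_eq_of_ne hk]
  mem := fun b k => by
    by_cases hk : k = i
    · subst hk; cases b <;> simp
    · simpa [Pi.single_eq_of_ne hk] using hx k
  card_lt := fun b => by
    refine Finset.card_lt_card (Finset.ssubset_iff_of_subset ?_ |>.2 ⟨i, ?_, ?_⟩)
    · intro k hk
      by_cases hki : k = i
      · exact mem_fracSet.2 ((hi k).2 hki)
      · simpa [mem_fracSet, Pi.single_eq_of_ne hki] using hk
    · exact mem_fracSet.2 ((hi i).2 rfl)
    · cases b <;> simp [mem_fracSet]
  sum_le := fun b c hc => by
    -- The other coordinates are 0 or 1, so their sum is an integer, and x i > 0 keeps it strictly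
    -- below c. This leaves room for rounding x i up.
    have hval : ∀ k ∈ Finset.univ.erase i, x k = ((if x k = 1 then 1 else 0 : ℕ) : ℝ) := by
      intro k hk
      rcases eq_zero_or_one (hx k) (fun h => Finset.ne_of_mem_erase hk ((hi k).1 h)) with h | h <;>
        simp [h]
    have hsum := Finset.add_sum_erase Finset.univ x (Finset.mem_univ i)
    rw [Finset.sum_congr rfl hval, ← Nat.cast_sum] at hsum
    have hpos := ((hi i).2 rfl).1
    have hlt : ((∑ k ∈ Finset.univ.erase i, if x k = 1 then 1 else 0 : ℕ) : ℝ) < c := by linarith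
    have hle : ((∑ k ∈ Finset.univ.erase i, if x k = 1 then 1 else 0 : ℕ) : ℝ) + 1 ≤ c := by
      exact_mod_cast Nat.succ_le_of_lt (by exact_mod_cast hlt)
    rw [Finset.sum_add_distrib, ← Finset.mul_sum, Finset.sum_pi_single', if_pos (Finset.mem_univ i)]
    cases b <;> simp <;> linarith

theorem isRoundingMove_pair {x : Fin n → ℝ} (hx : ∀ k, x k ∈ Set.Icc (0 : ℝ) 1) {i j : Fin n}
    (hij : i ≠ j) (hi : 0 < x i ∧ x i < 1) (hj : 0 < x j ∧ x j < 1) :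
    IsRoundingMove x
      (min (x i) (1 - x j) / (min (1 - x i) (x j) + min (x i) (1 - x j)))
      (fun b => if b then min (1 - x i) (x j) else -min (x i) (1 - x j))
      (Pi.single i 1 - Pi.single j 1) := by
  set d := min (1 - x i) (x j) with hd
  set d' := min (x i) (1 - x j) with hd'
  have dpos : 0 < d := lt_min (by linarith) hj.1
  have dpos' : 0 < d' := lt_min hi.1 (by linarith)
  have d1 : d ≤ 1 - x i := min_le_left _ _
  have d2 : d ≤ x j := min_le_right _ _
  have d1' : d' ≤ x i := min_le_left _ _
  have d2' : d' ≤ 1 - x j := min_le_right _ _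
  have ui : (Pi.single i 1 - Pi.single j 1 : Fin n → ℝ) i = 1 := by
    simp [Pi.single_eq_of_ne hij]
  have uj : (Pi.single i 1 - Pi.single j 1 : Fin n → ℝ) j = -1 := by
    simp [Pi.single_eq_of_ne hij.symm]
  have uk : ∀ k, k ≠ i → k ≠ j → (Pi.single i 1 - Pi.single j 1 : Fin n → ℝ) k = 0 := by
    intro k h1 h2
    simp [Pi.single_eq_of_ne h1, Pi.single_eq_of_ne h2]
  have hsum : ∑ k, (Pi.single i 1 - Pi.single j 1 : Fin n → ℝ) k = 0 := by
    simp [Finset.sum_sub_distrib]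
  generalize (Pi.single i 1 - Pi.single j 1 : Fin n → ℝ) = u at *
  refine ⟨by positivity, ?_, ?_, ?_, ?_, ?_, ?_⟩
  · rw [div_le_one (by positivity)]; linarith
  · simp only [if_true, Bool.false_eq_true, if_false]; field_simp; ring
  · intro k l hkl
    by_cases h1 : k = i
    · subst h1
      by_cases h2 : l = j
      · subst h2; rw [ui, uj]; norm_num
      · rw [uk l hkl.symm h2]; simp
    · by_cases h2 : k = j
      · subst h2
        by_cases h3 : l = i
        · subst h3; rw [ui, uj]; norm_num
        · rw [uk l h3 hkl.symm]; simp
      · rw [uk k h1 h2]; simp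
  · intro b k
    by_cases h1 : k = i
    · subst h1; rw [ui]; cases b <;> simp <;> constructor <;> linarith
    · by_cases h2 : k = j
      · subst h2; rw [uj]; cases b <;> simp <;> constructor <;> linarith
      · rw [uk k h1 h2]; simpa using hx k
  · intro b
    have hsub : (fracSet fun k => x k + (if b then d else -d') * u k) ⊆ fracSet x := by
      intro k hk
      by_cases h1 : k = i
      · subst h1; exact mem_fracSet.2 hi
      · by_cases h2 : k = j
        · subst h2; exact mem_fracSet.2 hj
        · simpa [mem_fracSet, uk k h1 h2] using hk
    refine Finset.card_lt_card ((Finset.ssubset_iff_of_subset hsub).2 ?_)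
    -- Whichever coordinate attains the minimum stops the move and becomes integral.
    cases b
    · rcases min_choice (x i) (1 - x j) with h | h
      · refine ⟨i, mem_fracSet.2 hi, ?_⟩
        rw [mem_fracSet, ui, hd', h]; simp
      · refine ⟨j, mem_fracSet.2 hj, ?_⟩
        rw [mem_fracSet, uj, hd', h]; simp
    · rcases min_choice (1 - x i) (x j) with h | h
      · refine ⟨i, mem_fracSet.2 hi, ?_⟩
        rw [mem_fracSet, ui, hd, h]; simp
      · refine ⟨j, mem_fracSet.2 hj, ?_⟩
        rw [mem_fracSet, uj, hd, h]; simp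
  · intro b c hc
    rw [Finset.sum_add_distrib, ← Finset.mul_sum, hsum]
    simpa using hc

/-- Merges the branches of a step into one alternative, nothing or a line move, so that the
inductions below need only the fields of `IsRoundingMove`. -/
theorem pivotStep_cases {x : Fin n → ℝ} (hx : ∀ k, x k ∈ Set.Icc (0 : ℝ) 1) :
    (fracSet x = ∅ ∧ pivotStep x = PMF.pure x) ∨
      ∃ q δ u, IsRoundingMove x q δ u ∧
        pivotStep x = (coin q).map fun b k => x k + δ b * u k := by
  unfold pivotStep
  have hmem : ∀ k, (0 < x k ∧ x k < 1) ↔ k ∈ fractional x := fun k => mem_fractional.symm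
  have hnodup : (fractional x).Nodup := Finset.sort_nodup _ _
  rcases hl : fractional x with _ | ⟨i, _ | ⟨j, l⟩⟩
  · left
    refine ⟨?_, rfl⟩
    ext k
    rw [mem_fracSet, hmem, hl]
    simp
  · right
    refine ⟨_, _, _, isRoundingMove_single (i := i) hx fun k => by rw [hmem, hl]; simp, ?_⟩
    dsimp only
    congr 1
    funext b k
    by_cases hk : k = i
    · subst hk; cases b <;> simp
    · cases b <;> simp [hk]
  · right
    rw [hl] at hnodup
    have hij : i ≠ j := fun h => by subst h; simp at hnodup
    refine ⟨_, _, _, isRoundingMove_pair hx hij ((hmem i).2 (by simp [hl]))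
      ((hmem j).2 (by simp [hl])), ?_⟩
    simp only [pivot]
    congr 1
    funext b k
    by_cases h1 : k = i
    · subst h1; cases b <;> simp [hij]; ring
    · by_cases h2 : k = j
      · subst h2; cases b <;> simp [h1]; ring
      · cases b <;> simp [h1, h2]

/-- Mean-zero moves make each coordinate a martingale. The bound on the number of fractional
coordinates ensures that k steps suffice to reach an integral point. -/
theorem prob_pivotSteps_eq {k : ℕ} : ∀ {x : Fin n → ℝ}, (∀ l, x l ∈ Set.Icc (0 : ℝ) 1) →
    (fracSet x).card ≤ k → ∀ i, prob (pivotSteps k x) {y | y i = 1} = x i := by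
  have base : ∀ {x : Fin n → ℝ}, (∀ l, x l ∈ Set.Icc (0 : ℝ) 1) → fracSet x = ∅ → ∀ i,
      x i = 0 ∨ x i = 1 := by
    intro x hx h i
    refine eq_zero_or_one (hx i) fun h' => ?_
    have := mem_fracSet.2 h'
    simp [h] at this
  induction k with
  | zero =>
    intro x hx hc i
    classical
    rw [pivotSteps, prob_pure]
    rcases base hx (Finset.card_eq_zero.1 (Nat.le_zero.1 hc)) i with h | h <;> simp [h]
  | succ k ih =>
    intro x hx hc i
    rw [pivotSteps]
    rcases pivotStep_cases hx with ⟨he, hp⟩ | ⟨q, δ, u, hm, hp⟩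
    · rw [hp, PMF.pure_bind, ih hx (by simp [he])]
    · rw [hp, PMF.bind_map, prob_bind, expect_coin hm.nonneg hm.le_one]
      have := fun b => ih (hm.mem b) (by have := hm.card_lt b; omega) i
      simp only [Function.comp_apply, this]
      linear_combination (u i) * hm.mean

/-- The product of two coordinates is a supermartingale: the terms linear in δ vanish in the mean,
and the quadratic one is δ² · u i · u j ≤ 0. No step count is needed, since on the cube the
indicator that both equal 1 is at most the product. -/
theorem prob_pivotSteps_pair_le {k : ℕ} : ∀ {x : Fin n → ℝ}, (∀ l, x l ∈ Set.Icc (0 : ℝ) 1) →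
    ∀ {i j}, i ≠ j → prob (pivotSteps k x) {y | y i = 1 ∧ y j = 1} ≤ x i * x j := by
  induction k with
  | zero =>
    intro x hx i j _
    classical
    rw [pivotSteps, prob_pure]
    split_ifs with h
    · rw [h.1, h.2, one_mul]
    · exact mul_nonneg (hx i).1 (hx j).1
  | succ k ih =>
    intro x hx i j hij
    rw [pivotSteps]
    rcases pivotStep_cases hx with ⟨he, hp⟩ | ⟨q, δ, u, hm, hp⟩
    · rw [hp, PMF.pure_bind]; exact ih hx hij
    · rw [hp, PMF.bind_map, prob_bind, expect_coin hm.nonneg hm.le_one]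
      have h := fun b => ih (hm.mem b) hij
      have h1 := mul_le_mul_of_nonneg_left (h true) hm.nonneg
      have h2 := mul_le_mul_of_nonneg_left (h false) (sub_nonneg.2 hm.le_one)
      have h3 := mul_nonneg hm.nonneg (mul_nonneg (sq_nonneg (δ true))
        (neg_nonneg.2 (hm.opposite i j hij)))
      have h4 := mul_nonneg (sub_nonneg.2 hm.le_one) (mul_nonneg (sq_nonneg (δ false))
        (neg_nonneg.2 (hm.opposite i j hij)))
      simp only [Function.comp_apply]
      refine (add_le_add h1 h2).trans ?_
      linear_combination h3 + h4 + (x i * u j + x j * u i) * hm.mean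

theorem support_pivotSteps {k : ℕ} : ∀ {x : Fin n → ℝ}, (∀ l, x l ∈ Set.Icc (0 : ℝ) 1) →
    ∀ {c : ℕ}, ∑ l, x l ≤ c → ∀ y ∈ (pivotSteps k x).support,
      (∀ l, y l ∈ Set.Icc (0 : ℝ) 1) ∧ ∑ l, y l ≤ c := by
  induction k with
  | zero =>
    intro x hx c hc y hy
    rw [pivotSteps, PMF.support_pure, Set.mem_singleton_iff] at hy
    exact hy ▸ ⟨hx, hc⟩
  | succ k ih =>
    intro x hx c hc y hy
    rw [pivotSteps] at hy
    rcases pivotStep_cases hx with ⟨he, hp⟩ | ⟨q, δ, u, hm, hp⟩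
    · rw [hp, PMF.pure_bind] at hy; exact ih hx hc y hy
    · rw [hp, PMF.bind_map, PMF.mem_support_bind_iff] at hy
      obtain ⟨b, _, hy⟩ := hy
      exact ih (hm.mem b) (hm.sum_le b c hc) y hy

variable {z : Fin n → ℝ}

theorem expect_pivotalSampling (hz : ∀ l, z l ∈ Set.Icc (0 : ℝ) 1) (i : Fin n) :
    expect (pivotalSampling z) (fun S => if i ∈ S then 1 else 0) = z i := by
  rw [← prob_setOf, pivotalSampling, prob_map]
  simpa using prob_pivotSteps_eq hz ((Finset.card_le_univ _).trans (by simp)) i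

theorem expect_pivotalSampling_pair_le (hz : ∀ l, z l ∈ Set.Icc (0 : ℝ) 1) {i j : Fin n}
    (hij : i ≠ j) :
    expect (pivotalSampling z) (fun S => if i ∈ S ∧ j ∈ S then 1 else 0) ≤ z i * z j := by
  rw [← prob_setOf, pivotalSampling, prob_map]
  simpa using prob_pivotSteps_pair_le hz hij

theorem card_le_of_mem_support_pivotalSampling (hz : ∀ l, z l ∈ Set.Icc (0 : ℝ) 1) {c : ℕ}
    (hc : ∑ l, z l ≤ c) {S : Finset (Fin n)} (hS : S ∈ (pivotalSampling z).support) :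
    S.card ≤ c := by
  rw [pivotalSampling, PMF.support_map] at hS
  obtain ⟨y, hy, rfl⟩ := hS
  obtain ⟨h1, h2⟩ := support_pivotSteps hz hc y hy
  have : ((Finset.univ.filter fun i => y i = 1).card : ℝ) ≤ ∑ l, y l := by
    rw [Finset.card_filter, Nat.cast_sum]
    refine Finset.sum_le_sum fun l _ => ?_
    split_ifs with h
    · simp [h]
    · simpa using (h1 l).1
  exact_mod_cast this.trans h2

end Pivotal

end OnlineAllocation

namespace OnlineAllocation

variable {n T : ℕ}

theorem expect_independentSubset_mem (b : Fin n → ℝ) (i : Fin n) :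
    expect (independentSubset b) (fun C => if i ∈ C then 1 else 0) = clamp (b i) := by
  simpa using expect_independentSubset b {i}

theorem expect_independentSubset_pair (b : Fin n → ℝ) {i j : Fin n} (hij : i ≠ j) :
    expect (independentSubset b) (fun C => if i ∈ C ∧ j ∈ C then 1 else 0) =
      clamp (b i) * clamp (b j) := by
  simpa [Finset.insert_subset_iff, Finset.prod_pair hij] using expect_independentSubset b {i, j}

/-! ## Consequences of LP feasibility -/

/-- The sum of `x i t` over the resources `t` before `k`. -/
def prefixSum (x : Fin n → Fin T → ℝ) (i : Fin n) (k : ℕ) : ℝ :=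
  ∑ t ∈ Finset.univ.filter fun t : Fin T => t.val < k, x i t

theorem filter_lt_succ (t : Fin T) :
    (Finset.univ.filter fun t' : Fin T => t'.val < t.val + 1) =
      insert t (Finset.univ.filter fun t' : Fin T => t'.val < t.val) := by
  ext t'
  simp only [Finset.mem_filter, Finset.mem_univ, true_and, Finset.mem_insert, Fin.ext_iff]
  omega

theorem prefixSum_zero (x : Fin n → Fin T → ℝ) (i : Fin n) : prefixSum x i 0 = 0 := by
  simp [prefixSum]

theorem prefixSum_succ (x : Fin n → Fin T → ℝ) (i : Fin n) (t : Fin T) :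
    prefixSum x i (t.val + 1) = prefixSum x i t.val + x i t := by
  rw [prefixSum, filter_lt_succ, Finset.sum_insert (by simp), add_comm, prefixSum]

theorem partialSum_eq_prefixSum (x : Fin n → Fin T → ℝ) (i : Fin n) (t : Fin T) :
    partialSum x i t = prefixSum x i t.val := by
  unfold partialSum prefixSum
  congr 1
  ext t'
  simp

section Feasible

variable {I : Instance n T} {x : Fin n → Fin T → ℝ} (hx : LPFeasible I x)
include hx

theorem LPFeasible.partialSum_nonneg (i : Fin n) (t : Fin T) : 0 ≤ partialSum x i t :=
  Finset.sum_nonneg fun t' _ => (hx.2 i t').1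

theorem LPFeasible.prefixSum_le_one (i : Fin n) {k : ℕ} (hk : k ≤ T) : prefixSum x i k ≤ 1 := by
  induction k with
  | zero => simp [prefixSum_zero]
  | succ k ih =>
    have h := (hx.2 i ⟨k, hk⟩).2
    have h' := prefixSum_succ x i ⟨k, hk⟩
    rw [partialSum_eq_prefixSum] at h
    have := ih (by omega)
    have := I.p_le_one ⟨k, hk⟩
    simp only at h h'
    nlinarith

theorem LPFeasible.partialSum_le_one (i : Fin n) (t : Fin T) : partialSum x i t ≤ 1 := by
  rw [partialSum_eq_prefixSum]
  exact hx.prefixSum_le_one i t.2.le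

/-- If p t = 0, feasibility forces x i t = 0, so the convention that division by 0 gives 0 is
harmless. -/
theorem LPFeasible.mul_div (i : Fin n) (t : Fin T) : I.p t * (x i t / I.p t) = x i t := by
  by_cases h : I.p t = 0
  · have := hx.2 i t
    rw [h, zero_mul] at this ⊢
    linarith
  · field_simp

theorem LPFeasible.div_nonneg (i : Fin n) (t : Fin T) : 0 ≤ x i t / I.p t :=
  _root_.div_nonneg (hx.2 i t).1 (I.p_nonneg t)

theorem LPFeasible.div_le (i : Fin n) (t : Fin T) : x i t / I.p t ≤ 1 - partialSum x i t := by
  have h := hx.partialSum_le_one i t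
  rcases (I.p_nonneg t).eq_or_lt with h0 | h0
  · rw [← h0, div_zero]; linarith
  · rw [div_le_iff₀ h0, mul_comm]
    exact (hx.2 i t).2

theorem LPFeasible.div_mem (i : Fin n) (t : Fin T) : x i t / I.p t ∈ Set.Icc (0 : ℝ) 1 :=
  ⟨hx.div_nonneg i t, (hx.div_le i t).trans (by linarith [hx.partialSum_nonneg i t])⟩

theorem LPFeasible.sum_div_le (t : Fin T) : ∑ i, x i t / I.p t ≤ I.c t := by
  rcases (I.p_nonneg t).eq_or_lt with h0 | h0
  · simp [← h0]
  · rw [← Finset.sum_div, div_le_iff₀ h0, mul_comm]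
    exact hx.1 t

end Feasible

/-! ## The acceptance probability of the first proposal -/

/-- The probability `max (θ, 1 - θ y)` that serves as a bound on the availability of a user. -/
def availBound (θ y : ℝ) : ℝ := max θ (1 - θ * y)

section Alpha

variable {κ : ℝ} (hκ₀ : 0 < κ) (hκ₁ : κ ≤ 0.0115) {x : Fin n → Fin T → ℝ} {i : Fin n} {t : Fin T}
  (hy₀ : 0 ≤ partialSum x i t) (hy₁ : partialSum x i t ≤ 1)
include hκ₀ hκ₁ hy₁

theorem one_sub_mul_partialSum_pos : 0 < 1 - (0.5 + κ) * partialSum x i t := by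
  norm_num at *
  nlinarith

/-- Capping the quotient at 1 amounts to raising its denominator to at least θ. This single formula
covers both regimes of `alpha` and is what cancels against the bound on availability. -/
theorem alpha_eq : alpha κ x i t = (0.5 + κ) / availBound (0.5 + κ) (partialSum x i t) := by
  have hpos := one_sub_mul_partialSum_pos hκ₀ hκ₁ hy₁
  have hθ : 0 < 0.5 + κ := by norm_num; linarith
  unfold alpha availBound
  rcases le_total (0.5 + κ) (1 - (0.5 + κ) * partialSum x i t) with h | h
  · rw [max_eq_right h, min_eq_right ((div_le_one hpos).2 h)]
  · rw [max_eq_left h, min_eq_left ((one_le_div hpos).2 h), div_self hθ.ne']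

theorem alpha_mul_availBound :
    alpha κ x i t * availBound (0.5 + κ) (partialSum x i t) = 0.5 + κ := by
  have hθ : 0 < 0.5 + κ := by norm_num; linarith
  rw [alpha_eq hκ₀ hκ₁ hy₁]
  exact div_mul_cancel₀ _ (lt_of_lt_of_le hθ (le_max_left _ _)).ne'

theorem alpha_pos : 0 < alpha κ x i t := by
  have hpos := one_sub_mul_partialSum_pos hκ₀ hκ₁ hy₁
  have hθ : 0 < 0.5 + κ := by norm_num; linarith
  exact lt_min one_pos (div_pos hθ hpos)

theorem alpha_eq_one_iff :
    alpha κ x i t = 1 ↔ 1 - (0.5 + κ) * partialSum x i t ≤ 0.5 + κ := by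
  rw [alpha, min_eq_left_iff, one_le_div (one_sub_mul_partialSum_pos hκ₀ hκ₁ hy₁)]

omit hκ₀ hκ₁ hy₁ in
theorem alpha_of_ne_one (h : alpha κ x i t ≠ 1) :
    alpha κ x i t = (0.5 + κ) / (1 - (0.5 + κ) * partialSum x i t) := by
  rw [alpha] at h ⊢
  exact (min_choice _ _).resolve_left h

include hy₀ in
theorem theta_le_alpha : 0.5 + κ ≤ alpha κ x i t := by
  have hpos := one_sub_mul_partialSum_pos hκ₀ hκ₁ hy₁
  have hθ : 0 < 0.5 + κ := by norm_num; linarith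
  refine le_min (by norm_num at *; linarith) ((le_div_iff₀ hpos).2 ?_)
  nlinarith [mul_nonneg hθ.le hy₀]

include hy₀ in
-- Since θ ≤ 1, also 1 - y ≤ 1 - θy, so the LP constraint x/p ≤ 1 - y caps the acceptance rate at θ.
-- The factor 1 - θ in `expect_step_pair_le` comes from here.
theorem alpha_mul_le {z : ℝ} (hz₀ : 0 ≤ z) (hz : z ≤ 1 - partialSum x i t) :
    alpha κ x i t * z ≤ 0.5 + κ := by
  have hpos := one_sub_mul_partialSum_pos hκ₀ hκ₁ hy₁
  have hθ : 0 < 0.5 + κ := by norm_num; linarith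
  refine (mul_le_mul_of_nonneg_right (min_le_right _ _) hz₀).trans ?_
  rw [div_mul_eq_mul_div, div_le_iff₀ hpos]
  refine mul_le_mul_of_nonneg_left (hz.trans ?_) hθ.le
  norm_num at *
  nlinarith

end Alpha

theorem alpha_le_one (κ : ℝ) (x : Fin n → Fin T → ℝ) (i : Fin n) (t : Fin T) :
    alpha κ x i t ≤ 1 := min_le_left _ _

/-! ## The two proposals -/

section Proposals

variable {I : Instance n T} {κ : ℝ} {x : Fin n → Fin T → ℝ} (hx : LPFeasible I x)
  (hκ₀ : 0 < κ) (hκ₁ : κ ≤ 0.0115)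

theorem expect_firstProposal (t : Fin T) (s : Record n T) (g : Finset (Fin n) → ℝ) :
    expect (firstProposal I κ x t s) g =
      expect (pivotalSampling fun i => x i t / I.p t) fun FP =>
        expect (independentSubset fun i => alpha κ x i t) fun C => g (FP ∩ C ∩ free s) := by
  simp only [firstProposal, expect_bind, expect_map]

theorem subset_free_of_mem_support {t : Fin T} {s : Record n T} {A : Finset (Fin n)}
    (hA : A ∈ (firstProposal I κ x t s).support) : A ⊆ free s := by
  simp only [firstProposal, PMF.mem_support_bind_iff, PMF.support_map] at hA
  obtain ⟨FP, _, C, _, rfl⟩ := hA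
  exact Finset.inter_subset_right

include hx in
theorem card_le_of_mem_support {t : Fin T} {s : Record n T} {A : Finset (Fin n)}
    (hA : A ∈ (firstProposal I κ x t s).support) : A.card ≤ I.c t := by
  simp only [firstProposal, PMF.mem_support_bind_iff, PMF.support_map] at hA
  obtain ⟨FP, hFP, C, _, rfl⟩ := hA
  exact (Finset.card_le_card (Finset.inter_subset_left.trans Finset.inter_subset_left)).trans
    (card_le_of_mem_support_pivotalSampling (fun i => hx.div_mem i t) (hx.sum_div_le t) hFP)

include hx hκ₀ hκ₁

theorem clamp_alpha (i : Fin n) (t : Fin T) : clamp (alpha κ x i t) = alpha κ x i t :=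
  clamp_of_mem (alpha_pos hκ₀ hκ₁ (hx.partialSum_le_one i t)).le (alpha_le_one _ _ _ _)

theorem expect_firstProposal_mem (t : Fin T) (s : Record n T) (i : Fin n) :
    expect (firstProposal I κ x t s) (fun A => if i ∈ A then 1 else 0) =
      (if i ∈ free s then 1 else 0) * (x i t / I.p t * alpha κ x i t) := by
  rw [expect_firstProposal]
  have h : ∀ FP C : Finset (Fin n), (if i ∈ FP ∩ C ∩ free s then (1 : ℝ) else 0) =
      (if i ∈ FP then 1 else 0) * ((if i ∈ C then 1 else 0) * if i ∈ free s then 1 else 0) := by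
    intro FP C
    by_cases h1 : i ∈ FP <;> by_cases h2 : i ∈ C <;> by_cases h3 : i ∈ free s <;> simp [h1, h2, h3]
  simp only [h, expect_const_mul, expect_mul_const, expect_independentSubset_mem,
    expect_pivotalSampling (fun i => hx.div_mem i t), clamp_alpha hx hκ₀ hκ₁]
  ring

/-- By inclusion-exclusion, correlation enters only through the event that both users are taken, and
there pivotal sampling is negatively correlated. -/
theorem expect_firstProposal_pair_le (t : Fin T) {s : Record n T} {i j : Fin n} (hij : i ≠ j)
    (hi : i ∈ free s) (hj : j ∈ free s) :
    expect (firstProposal I κ x t s) (fun A => if i ∉ A ∧ j ∉ A then 1 else 0) ≤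
      1 - x i t / I.p t * alpha κ x i t - x j t / I.p t * alpha κ x j t +
        (x i t / I.p t * alpha κ x i t) * (x j t / I.p t * alpha κ x j t) := by
  have h : ∀ A : Finset (Fin n), (if i ∉ A ∧ j ∉ A then (1 : ℝ) else 0) =
      (1 - (if i ∈ A then 1 else 0) - if j ∈ A then 1 else 0) + if i ∈ A ∧ j ∈ A then 1 else 0 := by
    intro A
    by_cases h1 : i ∈ A <;> by_cases h2 : j ∈ A <;> simp [h1, h2]
  have hpair : expect (firstProposal I κ x t s) (fun A => if i ∈ A ∧ j ∈ A then 1 else 0) ≤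
      (x i t / I.p t * alpha κ x i t) * (x j t / I.p t * alpha κ x j t) := by
    rw [expect_firstProposal]
    have h : ∀ FP C : Finset (Fin n),
        (if i ∈ FP ∩ C ∩ free s ∧ j ∈ FP ∩ C ∩ free s then (1 : ℝ) else 0) =
        (if i ∈ FP ∧ j ∈ FP then 1 else 0) * (if i ∈ C ∧ j ∈ C then 1 else 0) := by
      intro FP C
      by_cases h1 : i ∈ FP <;> by_cases h2 : j ∈ FP <;> by_cases h3 : i ∈ C <;>
        by_cases h4 : j ∈ C <;> simp [h1, h2, h3, h4, hi, hj]
    simp only [h, expect_const_mul, expect_mul_const, expect_independentSubset_pair _ hij,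
      clamp_alpha hx hκ₀ hκ₁]
    refine (mul_le_mul_of_nonneg_right
      (expect_pivotalSampling_pair_le (fun i => hx.div_mem i t) hij) ?_).trans_eq (by ring)
    exact mul_nonneg (alpha_pos hκ₀ hκ₁ (hx.partialSum_le_one i t)).le
      (alpha_pos hκ₀ hκ₁ (hx.partialSum_le_one j t)).le
  simp only [h, expect_add, expect_sub, expect_const, expect_firstProposal_mem hx hκ₀ hκ₁, hi, hj,
    if_true, one_mul]
  linarith

/-- The simulated variable dominates the linear expression 1 - 1[i ∈ A] - ∑_{j ≠ i} 1[j ∈ A]/c, so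
marginals alone suffice. -/
theorem le_expect_firstProposal (t : Fin T) {s : Record n T} {i : Fin n} (hi : i ∈ free s) :
    1 - x i t / I.p t * alpha κ x i t -
        ∑ j ∈ Finset.univ.erase i,
          (if j ∈ free s then 1 else 0) * (x j t / I.p t * alpha κ x j t) / I.c t ≤
      expect (firstProposal I κ x t s)
        (fun A => if i ∈ free s \ A then 1 - (A.card : ℝ) / I.c t else 0) := by
  have h : ∀ A : Finset (Fin n), 1 - (if i ∈ A then (1 : ℝ) else 0) -
      ∑ j ∈ Finset.univ.erase i, (if j ∈ A then 1 else 0) * (1 / I.c t : ℝ) ≤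
      if i ∈ free s \ A then 1 - (A.card : ℝ) / I.c t else 0 := by
    intro A
    rw [← Finset.sum_mul]
    have hnn : 0 ≤ (∑ j ∈ Finset.univ.erase i, if j ∈ A then (1 : ℝ) else 0) * (1 / I.c t) :=
      mul_nonneg (Finset.sum_nonneg fun j _ => by split_ifs <;> simp) (by positivity)
    by_cases hA : i ∈ A
    · simp only [hA, if_true, Finset.mem_sdiff, not_true, and_false, if_false]
      linarith
    · have hcard : (∑ j ∈ Finset.univ.erase i, if j ∈ A then (1 : ℝ) else 0) = A.card := by
        rw [Finset.sum_erase _ (by simp [hA])]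
        simp
      rw [hcard]
      simp [hA, hi, div_eq_mul_inv]
  refine le_of_eq_of_le ?_ (expect_mono fun A _ => h A)
  simp only [expect_sub, expect_const, expect_sum, expect_mul_const,
    expect_firstProposal_mem hx hκ₀ hκ₁, hi, if_true, one_mul]
  congr 1
  exact Finset.sum_congr rfl fun j _ => by ring

omit hκ₀ hκ₁ in
-- The second sample has marginals scaled by 1 - |A|/c, so the allocation probability is the
-- simulated variable times a constant. This is why that variable is the one to estimate.
theorem expect_secondProposal_mem (σ : Fin n → Fin T → ℝ) (t : Fin T) (s : Record n T)
    {A : Finset (Fin n)} (hA : A.card ≤ I.c t) (i : Fin n) :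
    expect (secondProposal I κ x σ t s A) (fun A₂ => if i ∈ A₂ then 1 else 0) =
      (if i ∈ free s \ A then 1 - (A.card : ℝ) / I.c t else 0) *
        (if alpha κ x i t = 1 then x i t / I.p t * clamp (betaHat κ x i t (σ i t)) else 0) := by
  have hfrac : 1 - (A.card : ℝ) / I.c t ∈ Set.Icc (0 : ℝ) 1 :=
    ⟨sub_nonneg.2 (div_le_one_of_le₀ (by exact_mod_cast hA) (by positivity)),
      sub_le_self _ (by positivity)⟩
  have hz : ∀ i, (1 - (A.card : ℝ) / I.c t) * (x i t / I.p t) ∈ Set.Icc (0 : ℝ) 1 := fun i =>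
    ⟨mul_nonneg hfrac.1 (hx.div_mem i t).1,
      mul_le_one₀ hfrac.2 (hx.div_mem i t).1 (hx.div_mem i t).2⟩
  simp only [secondProposal, expect_bind, expect_map]
  have h : ∀ SP C : Finset (Fin n),
      (if i ∈ (SP ∩ C ∩ (free s \ A)).filter (fun i => alpha κ x i t = 1) then (1 : ℝ) else 0) =
      (if i ∈ SP then 1 else 0) * ((if i ∈ C then 1 else 0) *
        ((if i ∈ free s \ A then 1 else 0) * if alpha κ x i t = 1 then 1 else 0)) := by
    intro SP C
    by_cases h1 : i ∈ SP <;> by_cases h2 : i ∈ C <;> by_cases h3 : i ∈ free s \ A <;>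
      by_cases h4 : alpha κ x i t = 1 <;> simp only [Finset.mem_filter, Finset.mem_inter, h1, h2,
        h3, h4, and_true, and_false, if_true, if_false, mul_one, mul_zero]
  simp only [h, expect_const_mul, expect_mul_const, expect_independentSubset_mem,
    expect_pivotalSampling hz]
  split_ifs <;> ring

omit hx hκ₀ hκ₁ in
theorem subset_of_mem_support_secondProposal {σ : Fin n → Fin T → ℝ} {t : Fin T} {s : Record n T}
    {A A₂ : Finset (Fin n)} (h : A₂ ∈ (secondProposal I κ x σ t s A).support) :
    A₂ ⊆ free s \ A := by
  simp only [secondProposal, PMF.mem_support_bind_iff, PMF.support_map] at h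
  obtain ⟨SP, _, C, _, rfl⟩ := h
  exact (Finset.filter_subset _ _).trans Finset.inter_subset_right

end Proposals

end OnlineAllocation

namespace OnlineAllocation

variable {n T : ℕ}

/-! ## The evolution of the record -/

/-- The record after resource `t` was allocated to `A₁` and `A₂` in its two proposals. -/
def extend (s : Record n T) (t : Fin T) (A₁ A₂ : Finset (Fin n)) : Record n T :=
  (s.1 ∪ A₁ ×ˢ {t}, s.2 ∪ A₂ ×ˢ {t})

theorem mem_free {s : Record n T} {i : Fin n} :
    i ∈ free s ↔ ∀ t, (i, t) ∉ s.1 ∧ (i, t) ∉ s.2 := by simp [free]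

theorem free_extend (s : Record n T) (t : Fin T) (A₁ A₂ : Finset (Fin n)) :
    free (extend s t A₁ A₂) = (free s \ A₁) \ A₂ := by
  ext i
  simp only [mem_free, extend, Finset.mem_union, Finset.mem_product, Finset.mem_singleton,
    Finset.mem_sdiff]
  constructor
  · intro h
    exact ⟨⟨fun t' => ⟨fun h' => (h t').1 (Or.inl h'), fun h' => (h t').2 (Or.inl h')⟩,
      fun h' => (h t).1 (Or.inr ⟨h', rfl⟩)⟩, fun h' => (h t).2 (Or.inr ⟨h', rfl⟩)⟩
  · rintro ⟨⟨h, h1⟩, h2⟩ t'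
    exact ⟨fun h' => h'.elim (h t').1 fun h' => h1 h'.1,
      fun h' => h'.elim (h t').2 fun h' => h2 h'.1⟩

/-- A record of the resources before `k` in which no pair was allocated twice. -/
def IsRecordBefore (k : ℕ) (s : Record n T) : Prop :=
  (∀ i t, (i, t) ∈ s.1 ∨ (i, t) ∈ s.2 → t.val < k) ∧ Disjoint s.1 s.2

section Run

variable (I : Instance n T) (κ : ℝ) (x σ : Fin n → Fin T → ℝ)

theorem expect_step (t : Fin T) (s : Record n T) (g : Record n T → ℝ) :
    expect (step I κ x σ t s) g = (1 - I.p t) * g s + I.p t *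
      expect (firstProposal I κ x t s) fun A₁ =>
        expect (secondProposal I κ x σ t s A₁) fun A₂ => g (extend s t A₁ A₂) := by
  rw [step, expect_bind, expect_coin (I.p_nonneg t) (I.p_le_one t), add_comm]
  simp [expect_bind, expect_map, expect_pure, extend]

theorem mem_support_step {t : Fin T} {s s' : Record n T}
    (h : s' ∈ (step I κ x σ t s).support) :
    s' = s ∨ ∃ A₁ A₂, A₂ ⊆ free s \ A₁ ∧ s' = extend s t A₁ A₂ := by
  rw [step, PMF.mem_support_bind_iff] at h
  obtain ⟨b, _, h⟩ := h
  cases b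
  · left
    simpa using h
  · right
    simp only [if_true, PMF.mem_support_bind_iff, PMF.support_map] at h
    obtain ⟨A₁, _, A₂, h₂, rfl⟩ := h
    exact ⟨A₁, A₂, subset_of_mem_support_secondProposal h₂, rfl⟩

theorem runUpTo_succ (t : Fin T) :
    runUpTo I κ x σ (t.val + 1) = (runUpTo I κ x σ t.val).bind (step I κ x σ t) := by
  rw [runUpTo]
  simp

theorem isRecordBefore_of_mem_support {k : ℕ} : k ≤ T → ∀ s ∈ (runUpTo I κ x σ k).support,
    IsRecordBefore k s := by
  induction k with
  | zero =>
    intro _ s hs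
    rw [runUpTo, PMF.support_pure, Set.mem_singleton_iff] at hs
    subst hs
    simp [IsRecordBefore]
  | succ k ih =>
    intro hk s' hs'
    rw [runUpTo_succ I κ x σ ⟨k, hk⟩, PMF.mem_support_bind_iff] at hs'
    obtain ⟨s, hs, hs'⟩ := hs'
    obtain ⟨h1, h2⟩ := ih (by omega) s hs
    rcases mem_support_step I κ x σ hs' with rfl | ⟨A₁, A₂, hA, rfl⟩
    · exact ⟨fun i t h => (h1 i t h).trans (Nat.lt_succ_self k), h2⟩
    · constructor
      · intro i t h
        simp only [extend, Finset.mem_union, Finset.mem_product, Finset.mem_singleton] at h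
        rcases h with (h | h) | (h | h)
        · exact (h1 i t (Or.inl h)).trans (Nat.lt_succ_self k)
        · rw [h.2]; exact Nat.lt_succ_self k
        · exact (h1 i t (Or.inr h)).trans (Nat.lt_succ_self k)
        · rw [h.2]; exact Nat.lt_succ_self k
      · rw [Finset.disjoint_left]
        rintro ⟨i, t⟩ he1 he2
        simp only [extend, Finset.mem_union, Finset.mem_product, Finset.mem_singleton] at he1 he2
        rcases he1 with he1 | ⟨he1, rfl⟩ <;> rcases he2 with he2 | ⟨he2, he⟩
        · exact Finset.disjoint_left.1 h2 he1 he2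
        · subst he
          exact lt_irrefl _ (h1 _ _ (Or.inl he1))
        · exact lt_irrefl _ (h1 _ _ (Or.inr he2))
        · exact (Finset.mem_sdiff.1 (hA he2)).2 he1

theorem runUpTo_congr {σ' : Fin n → Fin T → ℝ} {k : ℕ}
    (h : ∀ i (t : Fin T), t.val < k → σ i t = σ' i t) :
    runUpTo I κ x σ k = runUpTo I κ x σ' k := by
  induction k with
  | zero => rfl
  | succ k ih =>
    rw [runUpTo, runUpTo, ih fun i t ht => h i t (ht.trans (Nat.lt_succ_self k))]
    congr 1
    funext s
    split_ifs with hk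
    · have : (fun i => betaHat κ x i ⟨k, hk⟩ (σ i ⟨k, hk⟩)) =
          fun i => betaHat κ x i ⟨k, hk⟩ (σ' i ⟨k, hk⟩) := by
        funext i
        rw [h i ⟨k, hk⟩ (Nat.lt_succ_self k)]
      simp only [step, secondProposal, this]
    · rfl

/-- The probability that `i` is available just before resource `k`. -/
def freeProb (k : ℕ) (i : Fin n) : ℝ :=
  expect (runUpTo I κ x σ k) fun s => if i ∈ free s then 1 else 0

/-- The probability that both `i` and `j` are available just before resource `k`. -/
def jointFreeProb (k : ℕ) (i j : Fin n) : ℝ :=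
  expect (runUpTo I κ x σ k) fun s => if i ∈ free s ∧ j ∈ free s then 1 else 0

/-- The quantity that is estimated for the pair `(i, t)`. -/
def simulationMean (i : Fin n) (t : Fin T) : ℝ :=
  expect (runUpTo I κ x σ t.val) fun s => expect (firstProposal I κ x t s) fun A =>
    if i ∈ free s \ A then 1 - (A.card : ℝ) / I.c t else 0

theorem simulationMean_congr {σ' : Fin n → Fin T → ℝ} (i : Fin n) (t : Fin T)
    (h : ∀ i (t' : Fin T), t' < t → σ i t' = σ' i t') :
    simulationMean I κ x σ i t = simulationMean I κ x σ' i t := by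
  rw [simulationMean, simulationMean, runUpTo_congr I κ x σ fun i t' ht' => h i t' ht']

/-- The probability that `i` is allocated to `t` in the first proposal. -/
def firstProb (i : Fin n) (t : Fin T) : ℝ :=
  expect (runUpTo I κ x σ t.val) fun s => I.p t *
    expect (firstProposal I κ x t s) fun A => if i ∈ A then 1 else 0

/-- The probability that `i` is allocated to `t` in the second proposal. -/
def secondProb (i : Fin n) (t : Fin T) : ℝ :=
  expect (runUpTo I κ x σ t.val) fun s => I.p t *
    expect (firstProposal I κ x t s) fun A =>
      expect (secondProposal I κ x σ t s A) fun A₂ => if i ∈ A₂ then 1 else 0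

/-- A pair with resource t cannot be recorded before step t, and no later step touches it. -/
theorem expect_runUpTo_of_lt (i : Fin n) (t : Fin T) {k : ℕ} (htk : t.val < k) (hk : k ≤ T) :
    expect (runUpTo I κ x σ k) (fun s => if (i, t) ∈ s.1 then 1 else 0) =
        firstProb I κ x σ i t ∧
      expect (runUpTo I κ x σ k) (fun s => if (i, t) ∈ s.2 then 1 else 0) =
        secondProb I κ x σ i t := by
  induction k, Nat.succ_le_of_lt htk using Nat.le_induction with
  | base =>
    have hnot : ∀ s ∈ (runUpTo I κ x σ t.val).support, (i, t) ∉ s.1 ∧ (i, t) ∉ s.2 := by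
      intro s hs
      have := (isRecordBefore_of_mem_support I κ x σ t.2.le s hs).1 i t
      exact ⟨fun h => lt_irrefl _ (this (Or.inl h)), fun h => lt_irrefl _ (this (Or.inr h))⟩
    rw [Nat.succ_eq_add_one, runUpTo_succ, expect_bind, expect_bind]
    constructor <;> refine expect_congr fun s hs => ?_ <;>
      simp [expect_step, extend, hnot s hs, expect_const]
  | succ k hk' ih =>
    obtain ⟨ih1, ih2⟩ := ih (Nat.lt_of_succ_le hk') (by omega)
    rw [← ih1, ← ih2, runUpTo_succ I κ x σ ⟨k, hk⟩, expect_bind, expect_bind]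
    have hne : t ≠ ⟨k, hk⟩ := fun h => by
      have := Nat.lt_of_succ_le hk'
      rw [h] at this
      exact lt_irrefl _ this
    constructor <;> refine expect_congr fun s _ => ?_ <;> by_cases h1 : (i, t) ∈ s.1 <;>
      by_cases h2 : (i, t) ∈ s.2 <;> simp [expect_step, extend, h1, h2, hne.symm, expect_const]

theorem prob_run_fst (i : Fin n) (t : Fin T) :
    prob (run I κ x σ) {s | (i, t) ∈ s.1} = firstProb I κ x σ i t := by
  rw [prob_setOf]
  exact (expect_runUpTo_of_lt I κ x σ i t t.2 le_rfl).1

theorem prob_run_snd (i : Fin n) (t : Fin T) :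
    prob (run I κ x σ) {s | (i, t) ∈ s.2} = secondProb I κ x σ i t := by
  rw [prob_setOf]
  exact (expect_runUpTo_of_lt I κ x σ i t t.2 le_rfl).2

theorem freeProb_zero (i : Fin n) : freeProb I κ x σ 0 i = 1 := by
  simp [freeProb, runUpTo, expect_pure, mem_free]

/-- Both proposals take only free users, and the second avoids those taken by the first. The two
allocation events are therefore disjoint and lie in the event that i was free. -/
theorem freeProb_succ (i : Fin n) (t : Fin T) :
    freeProb I κ x σ (t.val + 1) i =
      freeProb I κ x σ t.val i - (firstProb I κ x σ i t + secondProb I κ x σ i t) := by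
  rw [freeProb, runUpTo_succ, expect_bind, freeProb, firstProb, secondProb, ← expect_add,
    ← expect_sub]
  refine expect_congr fun s _ => ?_
  rw [expect_step, ← mul_add, ← expect_add]
  have h : ∀ A₁ ∈ (firstProposal I κ x t s).support,
      (expect (secondProposal I κ x σ t s A₁) fun A₂ =>
        if i ∈ free (extend s t A₁ A₂) then 1 else 0) =
      (if i ∈ free s then 1 else 0) - ((if i ∈ A₁ then 1 else 0) +
        expect (secondProposal I κ x σ t s A₁) fun A₂ => if i ∈ A₂ then 1 else 0) := by
    intro A₁ h₁
    have hA₁ := subset_free_of_mem_support h₁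
    rw [← sub_sub, ← expect_const (secondProposal I κ x σ t s A₁)
      ((if i ∈ free s then 1 else 0) - if i ∈ A₁ then 1 else 0), ← expect_sub]
    refine expect_congr fun A₂ h₂ => ?_
    have hA₂ := subset_of_mem_support_secondProposal h₂
    rw [free_extend]
    by_cases hi2 : i ∈ A₂
    · have := Finset.mem_sdiff.1 (hA₂ hi2)
      simp [hi2, this.1, this.2]
    · by_cases hi1 : i ∈ A₁
      · simp [hi1, hi2, hA₁ hi1]
      · simp [hi1, hi2]
  rw [expect_congr h, expect_sub, expect_const]
  ring

theorem freeProb_eq (i : Fin n) {k : ℕ} (hk : k ≤ T) :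
    freeProb I κ x σ k i =
      1 - prefixSum (fun i t => firstProb I κ x σ i t + secondProb I κ x σ i t) i k := by
  induction k with
  | zero => rw [freeProb_zero, prefixSum_zero, sub_zero]
  | succ k ih =>
    have h1 := freeProb_succ I κ x σ i ⟨k, hk⟩
    have h2 := prefixSum_succ (fun i t => firstProb I κ x σ i t + secondProb I κ x σ i t) i ⟨k, hk⟩
    simp only at h1 h2
    rw [h1, h2, ih (by omega)]
    ring

theorem expect_welfare :
    expect (run I κ x σ) (welfare I) =
      ∑ i, ∑ t, (firstProb I κ x σ i t + secondProb I κ x σ i t) * I.v i t := by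
  have h : ∀ s ∈ (run I κ x σ).support, welfare I s = ∑ i, ∑ t,
      ((if (i, t) ∈ s.1 then 1 else 0) + if (i, t) ∈ s.2 then 1 else 0) * I.v i t := by
    intro s hs
    have hd := (isRecordBefore_of_mem_support I κ x σ le_rfl s hs).2
    rw [welfare, Finset.sum_union hd,
      ← Fintype.sum_prod_type' fun i t => ((if (i, t) ∈ s.1 then (1 : ℝ) else 0) +
        if (i, t) ∈ s.2 then 1 else 0) * I.v i t]
    simp [add_mul, Finset.sum_add_distrib]
  rw [expect_congr h]
  simp only [expect_sum, expect_mul_const, expect_add]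
  refine Finset.sum_congr rfl fun i _ => Finset.sum_congr rfl fun t _ => ?_
  have h := expect_runUpTo_of_lt I κ x σ i t t.2 le_rfl
  rw [run, h.1, h.2]

variable {I κ x} (hx : LPFeasible I x) (hκ₀ : 0 < κ) (hκ₁ : κ ≤ 0.0115)
include hx hκ₀ hκ₁

theorem firstProb_eq (i : Fin n) (t : Fin T) :
    firstProb I κ x σ i t = x i t * (alpha κ x i t * freeProb I κ x σ t.val i) := by
  simp only [firstProb, expect_firstProposal_mem hx hκ₀ hκ₁, expect_const_mul, expect_mul_const]
  rw [freeProb]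
  linear_combination (alpha κ x i t * expect (runUpTo I κ x σ t.val)
    fun s => if i ∈ free s then 1 else 0) * hx.mul_div i t

omit hκ₀ hκ₁ in
theorem secondProb_eq (i : Fin n) (t : Fin T) :
    secondProb I κ x σ i t = if alpha κ x i t = 1 then
      x i t * (simulationMean I κ x σ i t * clamp (betaHat κ x i t (σ i t))) else 0 := by
  have h : ∀ s, (expect (firstProposal I κ x t s) fun A =>
      expect (secondProposal I κ x σ t s A) fun A₂ => if i ∈ A₂ then 1 else 0) =
      (expect (firstProposal I κ x t s) fun A =>
        if i ∈ free s \ A then 1 - (A.card : ℝ) / I.c t else 0) *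
        (if alpha κ x i t = 1 then x i t / I.p t * clamp (betaHat κ x i t (σ i t)) else 0) := by
    intro s
    rw [← expect_mul_const]
    exact expect_congr fun A hA =>
      expect_secondProposal_mem hx σ t s (card_le_of_mem_support hx hA) i
  simp only [secondProb, h, expect_const_mul, expect_mul_const]
  rw [← simulationMean]
  split_ifs
  · linear_combination (simulationMean I κ x σ i t * clamp (betaHat κ x i t (σ i t))) *
      hx.mul_div i t
  · ring

/-- Ignoring second proposals only helps survival. With w = (x/p)·α, the pair survives with
probability at most 1 - p·w_i - p·w_j + p·w_i·w_j; as w_j ≤ θ, the cross term costs at most a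
fraction θ of p·w_i. The product form can be iterated. -/
theorem expect_step_pair_le (t : Fin T) (s : Record n T) {i j : Fin n} (hij : i ≠ j) :
    expect (step I κ x σ t s) (fun s => if i ∈ free s ∧ j ∈ free s then 1 else 0) ≤
      (if i ∈ free s ∧ j ∈ free s then 1 else 0) *
        ((1 - x j t * alpha κ x j t) *
          (1 - (1 - (0.5 + κ)) * (x i t * alpha κ x i t))) := by
  rw [expect_step]
  simp only [free_extend, Finset.mem_sdiff]
  by_cases hs : i ∈ free s ∧ j ∈ free s
  · have h : ∀ A₁, (expect (secondProposal I κ x σ t s A₁) fun A₂ =>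
        if ((i ∈ free s ∧ i ∉ A₁) ∧ i ∉ A₂) ∧ (j ∈ free s ∧ j ∉ A₁) ∧ j ∉ A₂ then 1 else 0) ≤
        if i ∉ A₁ ∧ j ∉ A₁ then (1 : ℝ) else 0 := by
      intro A₁
      rw [← expect_const (secondProposal I κ x σ t s A₁) (if i ∉ A₁ ∧ j ∉ A₁ then (1 : ℝ) else 0)]
      refine expect_mono fun A₂ _ => ?_
      split_ifs with h1 h2 h2
      · exact le_rfl
      · exact absurd ⟨h1.1.1.2, h1.2.1.2⟩ h2
      · exact zero_le_one
      · exact le_rfl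
    have h1 := (expect_mono (μ := firstProposal I κ x t s) fun A₁ _ => h A₁).trans
      (expect_firstProposal_pair_le hx hκ₀ hκ₁ t hij hs.1 hs.2)
    simp only [hs, and_self, if_true, mul_one, one_mul, true_and] at h1 ⊢
    have h2 := mul_le_mul_of_nonneg_left h1 (I.p_nonneg t)
    have hp := I.p_nonneg t
    have hp1 := I.p_le_one t
    have hwj : x j t / I.p t * alpha κ x j t ≤ 0.5 + κ := by
      rw [mul_comm]
      exact alpha_mul_le hκ₀ hκ₁ (hx.partialSum_nonneg j t) (hx.partialSum_le_one j t)
        (hx.div_nonneg j t) (hx.div_le j t)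
    have hwj0 : 0 ≤ x j t / I.p t * alpha κ x j t :=
      mul_nonneg (hx.div_nonneg j t) (alpha_pos hκ₀ hκ₁ (hx.partialSum_le_one j t)).le
    have hwi0 : 0 ≤ x i t / I.p t * alpha κ x i t :=
      mul_nonneg (hx.div_nonneg i t) (alpha_pos hκ₀ hκ₁ (hx.partialSum_le_one i t)).le
    rw [← hx.mul_div i t, ← hx.mul_div j t, mul_assoc, mul_assoc]
    generalize x i t / I.p t * alpha κ x i t = wi at *
    generalize x j t / I.p t * alpha κ x j t = wj at *
    refine (add_le_add_right h2 _).trans ?_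
    have hμ : (0 : ℝ) ≤ 1 - (0.5 + κ) := by norm_num at *; linarith
    have h3 := mul_nonneg (mul_nonneg hp hwi0) (sub_nonneg.2 hwj)
    have h4 := mul_nonneg (mul_nonneg hp hwi0) (mul_nonneg (mul_nonneg hμ hp) hwj0)
    linear_combination h3 + h4
  · have h : ∀ A₁ A₂ : Finset (Fin n),
        ¬(((i ∈ free s ∧ i ∉ A₁) ∧ i ∉ A₂) ∧ (j ∈ free s ∧ j ∉ A₁) ∧ j ∉ A₂) :=
      fun A₁ A₂ h => hs ⟨h.1.1.1, h.2.1.1⟩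
    simp [hs, h, expect_const]

end Run

/-! ### Joint availability of two users and the lower bound on the estimated mean -/

/-- The hypothesis on a makes the left side the old bound minus θw, and the maximum cannot drop by
more than θw when y grows by w. -/
theorem availBound_step {θ y a w : ℝ} (hθ : 0 < θ) (ha : a * availBound θ y = θ) (hw : 0 ≤ w) :
    availBound θ y * (1 - w * a) ≤ availBound θ (y + w) := by
  have h : availBound θ y * (1 - w * a) = availBound θ y - θ * w := by
    linear_combination (-w) * ha
  rw [h]
  unfold availBound
  rcases le_total θ (1 - θ * y) with h | h
  · rw [max_eq_right h]
    exact le_of_eq_of_le (by ring) (le_max_right _ _)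
  · rw [max_eq_left h]
    exact (sub_le_self _ (by positivity)).trans (le_max_left _ _)

/-- It rests on (1 - cw)(1 + c(y + w)) ≤ 1 + cy: repeated factors 1 - cw are bounded by 1/(1 + c·∑w)
without exponentials. -/
theorem inv_step {c y w b : ℝ} (hc : 0 ≤ c) (hy : 0 ≤ y) (hw : 0 ≤ w) (hb : c * w ≤ b) :
    1 / (1 + c * y) * (1 - b) ≤ 1 / (1 + c * (y + w)) := by
  have h1 : 0 < 1 + c * y := by positivity
  have h2 : 0 < 1 + c * (y + w) := by positivity
  rw [div_mul_eq_mul_div, div_le_div_iff₀ h1 h2]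
  have h3 := mul_le_mul_of_nonneg_right hb h2.le
  have h4 : 0 ≤ c * w * (c * (y + w)) := by positivity
  linarith

section Joint

variable {I : Instance n T} {κ : ℝ} {x : Fin n → Fin T → ℝ} (σ : Fin n → Fin T → ℝ)
  (hx : LPFeasible I x) (hκ₀ : 0 < κ) (hκ₁ : κ ≤ 0.0115)
include hx hκ₀ hκ₁

/-- The factors of j iterate through `availBound_step`; those of i, weakened by α ≥ θ, iterate
through `inv_step`. The bound for j is shaped to cancel its acceptance probability later. -/
theorem jointFreeProb_le {i j : Fin n} (hij : i ≠ j) {k : ℕ} (hk : k ≤ T) :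
    jointFreeProb I κ x σ k i j ≤ availBound (0.5 + κ) (prefixSum x j k) *
      (1 / (1 + (0.5 + κ) * (1 - (0.5 + κ)) * prefixSum x i k)) := by
  have hθ : 0 < 0.5 + κ := by norm_num; linarith
  have hμ : 0 < 1 - (0.5 + κ) := by norm_num at *; linarith
  induction k with
  | zero =>
    simp [jointFreeProb, runUpTo, expect_pure, mem_free, prefixSum_zero, availBound]
  | succ k ih =>
    set t : Fin T := ⟨k, hk⟩ with ht
    have hyi := partialSum_eq_prefixSum x i t
    have hyj := partialSum_eq_prefixSum x j t
    have h1 : jointFreeProb I κ x σ (k + 1) i j ≤ jointFreeProb I κ x σ k i j *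
        ((1 - x j t * alpha κ x j t) * (1 - (1 - (0.5 + κ)) * (x i t * alpha κ x i t))) := by
      rw [jointFreeProb, runUpTo_succ I κ x σ t, expect_bind, jointFreeProb, ← expect_mul_const]
      exact expect_mono fun s _ => expect_step_pair_le σ hx hκ₀ hκ₁ t s hij
    have hle : ∀ l, 0 ≤ 1 - x l t * alpha κ x l t := by
      intro l
      have h2 := (hx.div_mem l t).2
      have h3 := hx.mul_div l t
      have h4 : x l t ≤ 1 := by
        rw [← h3]
        exact mul_le_one₀ (I.p_le_one t) (hx.div_mem l t).1 h2
      exact sub_nonneg.2 (mul_le_one₀ h4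
        (alpha_pos hκ₀ hκ₁ (hx.partialSum_le_one l t)).le (alpha_le_one κ x l t))
    have hle' : 0 ≤ 1 - (1 - (0.5 + κ)) * (x i t * alpha κ x i t) := by
      have := hle i
      have h5 : 0 ≤ x i t * alpha κ x i t :=
        mul_nonneg (hx.2 i t).1 (alpha_pos hκ₀ hκ₁ (hx.partialSum_le_one i t)).le
      nlinarith
    have hav : ∀ y, 0 ≤ availBound (0.5 + κ) y := fun y => hθ.le.trans (le_max_left _ _)
    have hy0 := hx.partialSum_nonneg i t
    have hs1 := availBound_step hθ
      (alpha_mul_availBound hκ₀ hκ₁ (hx.partialSum_le_one j t)) (hx.2 j t).1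
    have hs2 := inv_step (c := (0.5 + κ) * (1 - (0.5 + κ))) (mul_pos hθ hμ).le hy0 (hx.2 i t).1
      (b := (1 - (0.5 + κ)) * (x i t * alpha κ x i t)) (by
        have := mul_le_mul_of_nonneg_left
          (theta_le_alpha hκ₀ hκ₁ hy0 (hx.partialSum_le_one i t)) (mul_nonneg hμ.le (hx.2 i t).1)
        linarith)
    have hpi := prefixSum_succ x i t
    have hpj := prefixSum_succ x j t
    rw [hyi] at hs2 hy0
    rw [hyj] at hs1
    simp only [ht] at hpi hpj hs1 hs2 hy0
    rw [hpi, hpj]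
    refine h1.trans ((mul_le_mul_of_nonneg_right (ih (by omega))
      (mul_nonneg (hle j) hle')).trans ?_)
    refine le_of_eq_of_le ?_ (mul_le_mul hs1 hs2 (mul_nonneg ?_ hle') (hav _))
    · ring
    · have := mul_pos hθ hμ
      positivity

/-- The LP constraint gives 1 - x/p ≥ y, the chance that i is not taken. Each other user j uses an
expected capacity share of at most θK·(x_j/p)/c on the event that i is free, since α_j times the
availability bound of j is θ; the shares add up to at most θK by the capacity constraint. -/
theorem le_simulationMean (i : Fin n) (t : Fin T) (hα : alpha κ x i t = 1) :
    freeProb I κ x σ t.val i * partialSum x i t -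
        (0.5 + κ) / (1 + (0.5 + κ) * (1 - (0.5 + κ)) * partialSum x i t) ≤
      simulationMean I κ x σ i t := by
  set K := 1 / (1 + (0.5 + κ) * (1 - (0.5 + κ)) * partialSum x i t) with hK
  have hθ : 0 < 0.5 + κ := by norm_num; linarith
  have hμ : 0 < 1 - (0.5 + κ) := by norm_num at *; linarith
  have hy0 := hx.partialSum_nonneg i t
  have hK0 : 0 ≤ K := by
    have := mul_pos hθ hμ
    positivity
  have h : ∀ s, (if i ∈ free s then (1 : ℝ) else 0) * (1 - x i t / I.p t) -
      ∑ j ∈ Finset.univ.erase i, (if i ∈ free s ∧ j ∈ free s then 1 else 0) *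
        (x j t / I.p t * alpha κ x j t / I.c t) ≤
      expect (firstProposal I κ x t s)
        (fun A => if i ∈ free s \ A then 1 - (A.card : ℝ) / I.c t else 0) := by
    intro s
    by_cases hs : i ∈ free s
    · refine le_of_eq_of_le ?_ (le_expect_firstProposal hx hκ₀ hκ₁ t hs)
      simp only [hs, hα, if_true, true_and, one_mul, mul_one, mul_div_assoc]
    · simp [hs, expect_const]
  refine le_trans ?_ (expect_mono (μ := runUpTo I κ x σ t.val) fun s _ => h s)
  rw [expect_sub, expect_mul_const, expect_sum]
  simp only [expect_mul_const]
  have hfree : 0 ≤ freeProb I κ x σ t.val i :=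
    expect_nonneg fun s _ => by split_ifs <;> simp
  refine sub_le_sub (mul_le_mul_of_nonneg_left ?_ hfree) ?_
  · linarith [hx.div_le i t]
  · have hterm : ∀ j ∈ Finset.univ.erase i, (expect (runUpTo I κ x σ t.val)
        fun s => if i ∈ free s ∧ j ∈ free s then 1 else 0) *
          (x j t / I.p t * alpha κ x j t / I.c t) ≤
        (0.5 + κ) * K * (x j t / I.p t / I.c t) := by
      intro j hj
      have h1 := jointFreeProb_le σ hx hκ₀ hκ₁ (Finset.ne_of_mem_erase hj).symm t.2.le
      rw [← partialSum_eq_prefixSum, ← partialSum_eq_prefixSum, ← hK] at h1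
      have h2 := alpha_mul_availBound hκ₀ hκ₁ (hx.partialSum_le_one j t)
      have h3 : 0 ≤ x j t / I.p t * alpha κ x j t / I.c t :=
        div_nonneg (mul_nonneg (hx.div_nonneg j t)
          (alpha_pos hκ₀ hκ₁ (hx.partialSum_le_one j t)).le) (Nat.cast_nonneg _)
      refine (mul_le_mul_of_nonneg_right h1 h3).trans_eq ?_
      linear_combination K * (x j t / I.p t / I.c t) * h2
    refine (Finset.sum_le_sum hterm).trans ?_
    rw [← Finset.mul_sum, div_eq_mul_one_div (0.5 + κ), ← hK]
    refine mul_le_of_le_one_right (by positivity) ?_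
    rw [← Finset.sum_div]
    refine div_le_one_of_le₀ ((Finset.sum_le_sum_of_subset_of_nonneg (Finset.subset_univ _)
      fun j _ _ => hx.div_nonneg j t).trans (hx.sum_div_le t)) (Nat.cast_nonneg _)

end Joint

end OnlineAllocation

namespace OnlineAllocation

/-! ## Concentration of empirical averages -/

section Concentration

variable {α β : Type}

/-- The expectation of a function with values in `[0, ∞]`. -/
def lexpect (μ : PMF α) (g : α → ENNReal) : ENNReal := ∑' a, μ a * g a

theorem lexpect_bind (μ : PMF α) (f : α → PMF β) (g : β → ENNReal) :
    lexpect (μ.bind f) g = lexpect μ fun a => lexpect (f a) g := by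
  simp only [lexpect, PMF.bind_apply, ← ENNReal.tsum_mul_left, ← ENNReal.tsum_mul_right]
  rw [ENNReal.tsum_comm]
  simp only [mul_assoc]

theorem lexpect_pure (a : α) (g : α → ENNReal) : lexpect (PMF.pure a) g = g a := by
  classical
  rw [lexpect, tsum_eq_single a fun b hb => by simp [PMF.pure_apply, hb]]
  simp

theorem lexpect_map (μ : PMF α) (f : α → β) (g : β → ENNReal) :
    lexpect (μ.map f) g = lexpect μ fun a => g (f a) := by
  rw [← PMF.bind_pure_comp, lexpect_bind]
  simp [lexpect_pure]

theorem lexpect_ofReal [Fintype α] (μ : PMF α) {f : α → ℝ} (hf : ∀ a, 0 ≤ f a) :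
    lexpect μ (fun a => ENNReal.ofReal (f a)) = ENNReal.ofReal (expect μ f) := by
  rw [lexpect, tsum_fintype, expect, ENNReal.ofReal_sum_of_nonneg
    fun a _ => mul_nonneg ENNReal.toReal_nonneg (hf a)]
  refine Finset.sum_congr rfl fun a _ => ?_
  rw [ENNReal.ofReal_mul ENNReal.toReal_nonneg, ENNReal.ofReal_toReal (μ.apply_ne_top a)]

theorem toOuterMeasure_le_lexpect (μ : PMF α) {S : Set α} {g : α → ENNReal}
    (h : ∀ a ∈ S, 1 ≤ g a) : μ.toOuterMeasure S ≤ lexpect μ g := by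
  rw [PMF.toOuterMeasure_apply]
  refine ENNReal.tsum_le_tsum fun a => ?_
  by_cases ha : a ∈ S
  · simpa [ha] using le_mul_of_one_le_right' (h a ha)
  · simp [ha]

theorem toOuterMeasure_bind_le {μ : PMF α} {f : α → PMF β} {S : Set β} {B : Set α} {c : ENNReal}
    (h : ∀ a ∉ B, (f a).toOuterMeasure S ≤ c) :
    (μ.bind f).toOuterMeasure S ≤ μ.toOuterMeasure B + c := by
  rw [PMF.toOuterMeasure_bind_apply, PMF.toOuterMeasure_apply, ← mul_one c, ← μ.tsum_coe,
    ← ENNReal.tsum_mul_left, ← ENNReal.tsum_add]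
  refine ENNReal.tsum_le_tsum fun a => ?_
  by_cases ha : a ∈ B
  · simpa [ha] using (mul_le_of_le_one_right' (toOuterMeasure_le_one (f a) S)).trans
      (le_self_add (b := c * μ a))
  · simpa [ha, mul_comm c] using mul_le_mul_right (h a ha) (μ a)

theorem lexpect_exp_iidSum (μ : PMF ℝ) (l : ℝ) (N : ℕ) :
    lexpect (iidSum μ N) (fun s => ENNReal.ofReal (Real.exp (l * s))) =
      lexpect μ (fun v => ENNReal.ofReal (Real.exp (l * v))) ^ N := by
  induction N with
  | zero => simp [iidSum, lexpect_pure]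
  | succ N ih =>
    rw [iidSum, lexpect_bind, pow_succ, ← ih]
    simp only [lexpect_map, mul_add, Real.exp_add, ENNReal.ofReal_mul (Real.exp_nonneg _)]
    simp only [lexpect, ENNReal.tsum_mul_left, mul_left_comm _ (ENNReal.ofReal _)]
    simp only [mul_left_comm (ENNReal.ofReal _), ← mul_assoc, ENNReal.tsum_mul_right]

theorem exp_le_chord {v : ℝ} (h₀ : 0 ≤ v) (h₁ : v ≤ 1) (l : ℝ) :
    Real.exp (l * v) ≤ (1 - v) + v * Real.exp l := by
  have h := convexOn_exp.2 (Set.mem_univ 0) (Set.mem_univ l) (sub_nonneg.2 h₁) h₀ (by ring)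
  simpa [mul_comm] using h

/-- Apply 1 + u ≤ exp u with u = m(exp l - 1), and exp l - 1 ≤ l + l² for |l| ≤ 1. The constant is
cruder than Hoeffding's, but N has ample slack. -/
theorem chord_le_exp {m l : ℝ} (h₀ : 0 ≤ m) (h₁ : m ≤ 1) (hl : |l| ≤ 1) :
    (1 - m) + m * Real.exp l ≤ Real.exp (l * m + l ^ 2) := by
  have h := (abs_le.1 (Real.abs_exp_sub_one_sub_id_le hl)).2
  have h2 := Real.add_one_le_exp (m * (Real.exp l - 1))
  have h3 : Real.exp (m * (Real.exp l - 1)) ≤ Real.exp (l * m + l ^ 2) := by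
    refine Real.exp_le_exp.2 ?_
    nlinarith [sq_nonneg l]
  linarith

/-- A Chernoff bound for one tail. -/
theorem toOuterMeasure_iidSum_le {μ : PMF ℝ} {m l : ℝ}
    (hμ : lexpect μ (fun v => ENNReal.ofReal (Real.exp (l * v))) ≤
      ENNReal.ofReal (Real.exp (l * m + l ^ 2))) (N : ℕ) :
    (iidSum μ N).toOuterMeasure {s | 2 * N * l ^ 2 ≤ l * (s - N * m)} ≤
      ENNReal.ofReal (Real.exp (-(N * l ^ 2))) := by
  -- Markov's inequality for exp(l s). The sign of l is free, so one statement serves both tails.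
  have h1 : ∀ s ∈ {s : ℝ | 2 * N * l ^ 2 ≤ l * (s - N * m)}, 1 ≤
      ENNReal.ofReal (Real.exp (-(2 * N * l ^ 2 + l * N * m))) *
        ENNReal.ofReal (Real.exp (l * s)) := by
    intro s hs
    rw [← ENNReal.ofReal_mul (Real.exp_nonneg _), ← Real.exp_add, ENNReal.one_le_ofReal,
      Real.one_le_exp_iff]
    have : 2 * N * l ^ 2 ≤ l * (s - N * m) := hs
    linarith
  refine (toOuterMeasure_le_lexpect _ h1).trans ?_
  have h2 : ∀ (ν : PMF ℝ) (c : ENNReal) (g : ℝ → ENNReal),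
      lexpect ν (fun s => c * g s) = c * lexpect ν g := by
    intro ν c g
    simp only [lexpect, mul_left_comm _ c, ENNReal.tsum_mul_left]
  rw [h2, lexpect_exp_iidSum]
  refine (mul_le_mul_right (pow_le_pow_left' hμ N) _).trans_eq ?_
  rw [← ENNReal.ofReal_pow (Real.exp_nonneg _), ← ENNReal.ofReal_mul (Real.exp_nonneg _),
    ← Real.exp_nat_mul, ← Real.exp_add]
  congr 2
  ring

theorem toOuterMeasure_empiricalAverage_le {μ : PMF ℝ} {m δ : ℝ}
    (hμ : ∀ l : ℝ, |l| ≤ 1 → lexpect μ (fun v => ENNReal.ofReal (Real.exp (l * v))) ≤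
      ENNReal.ofReal (Real.exp (l * m + l ^ 2))) (hδ₀ : 0 ≤ δ) (hδ : δ ≤ 2) {N : ℕ} (hN : 0 < N) :
    (empiricalAverage μ N).toOuterMeasure {v | ¬|v - m| ≤ δ} ≤
      ENNReal.ofReal (2 * Real.exp (-(N * δ ^ 2 / 4))) := by
  have hN' : (0 : ℝ) < N := by exact_mod_cast hN
  rw [empiricalAverage, PMF.toOuterMeasure_map_apply]
  -- With l = ±δ/2, a deviation of the average beyond δ lies in one of the two Chernoff events, each
  -- of probability at most exp(-Nδ²/4).
  have hsub : (fun s : ℝ => s / N) ⁻¹' {v | ¬|v - m| ≤ δ} ⊆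
      {s | 2 * N * (δ / 2) ^ 2 ≤ δ / 2 * (s - N * m)} ∪
        {s | 2 * N * (-(δ / 2)) ^ 2 ≤ -(δ / 2) * (s - N * m)} := by
    intro s hs
    have hs' : δ < |s / N - m| := not_le.1 hs
    have hmul : s - N * m = N * (s / N - m) := by field_simp
    rcases lt_abs.1 hs' with h | h
    · left
      change 2 * N * (δ / 2) ^ 2 ≤ δ / 2 * (s - N * m)
      rw [hmul]
      have := mul_le_mul_of_nonneg_left h.le (mul_nonneg hδ₀ hN'.le)
      linarith
    · right
      change 2 * N * (-(δ / 2)) ^ 2 ≤ -(δ / 2) * (s - N * m)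
      rw [hmul]
      have := mul_le_mul_of_nonneg_left h.le (mul_nonneg hδ₀ hN'.le)
      linarith
  have h1 := toOuterMeasure_iidSum_le (hμ (δ / 2) (by rw [abs_of_nonneg] <;> linarith)) N
  have h2 := toOuterMeasure_iidSum_le
    (hμ (-(δ / 2)) (by rw [abs_neg, abs_of_nonneg] <;> linarith)) N
  refine ((MeasureTheory.measure_mono hsub).trans (MeasureTheory.measure_union_le _ _)).trans
    ((add_le_add h1 h2).trans_eq ?_)
  rw [← ENNReal.ofReal_add (Real.exp_nonneg _) (Real.exp_nonneg _)]
  congr 1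
  rw [two_mul]
  congr 2 <;> ring_nf

end Concentration

/-! ## The estimates are accurate with high probability -/

section Estimates

variable {n T : ℕ} {I : Instance n T} {κ : ℝ} {x : Fin n → Fin T → ℝ} (hx : LPFeasible I x)
include hx

theorem simulated_mem {t : Fin T} {s : Record n T} {A : Finset (Fin n)} (i : Fin n)
    (hA : A ∈ (firstProposal I κ x t s).support) :
    (if i ∈ free s \ A then 1 - (A.card : ℝ) / I.c t else 0) ∈ Set.Icc (0 : ℝ) 1 := by
  have h := card_le_of_mem_support hx hA
  split_ifs
  · exact ⟨sub_nonneg.2 (div_le_one_of_le₀ (by exact_mod_cast h) (by positivity)),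
      sub_le_self _ (by positivity)⟩
  · simp

theorem simulationMean_mem (σ : Fin n → Fin T → ℝ) (i : Fin n) (t : Fin T) :
    simulationMean I κ x σ i t ∈ Set.Icc (0 : ℝ) 1 := by
  refine ⟨expect_nonneg fun s _ => expect_nonneg fun A hA => (simulated_mem hx i hA).1, ?_⟩
  have h := expect_mono (μ := runUpTo I κ x σ t.val) fun s _ =>
    expect_mono (μ := firstProposal I κ x t s) fun A hA => (simulated_mem hx i hA).2
  simp only [expect_const] at h
  exact h

/-- By convexity, a variable in [0, 1] has at most the exponential moment of a Bernoulli variable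
with the same mean. -/
theorem lexpect_exp_simulation_le (σ : Fin n → Fin T → ℝ) (i : Fin n) (t : Fin T) {l : ℝ}
    (hl : |l| ≤ 1) :
    lexpect (simulation I κ x σ i t) (fun v => ENNReal.ofReal (Real.exp (l * v))) ≤
      ENNReal.ofReal (Real.exp (l * simulationMean I κ x σ i t + l ^ 2)) := by
  simp only [simulation, lexpect_bind, lexpect_map]
  simp only [lexpect_ofReal _ fun _ => Real.exp_nonneg _]
  rw [lexpect_ofReal _ fun s => expect_nonneg fun A _ => Real.exp_nonneg _]
  refine ENNReal.ofReal_le_ofReal ?_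
  have hm := simulationMean_mem hx (κ := κ) σ i t
  refine le_trans ?_ (chord_le_exp hm.1 hm.2 hl)
  refine (expect_mono fun s _ => expect_mono fun A hA => exp_le_chord (simulated_mem hx i hA).1
    (simulated_mem hx i hA).2 l).trans_eq ?_
  simp only [expect_add, expect_sub, expect_const, expect_mul_const]
  rfl

omit hx in
theorem support_foldlM_update (t : Fin T) (ρ : Fin n → PMF ℝ) (l : List (Fin n)) :
    ∀ σ : Fin n → Fin T → ℝ, ∀ σ' ∈ (l.foldlM (fun σ' i => (ρ i).map fun v =>
      Function.update σ' i (Function.update (σ' i) t v)) σ).support,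
      ∀ i t', (i ∉ l ∨ t' ≠ t) → σ' i t' = σ i t' := by
  induction l with
  | nil =>
    intro σ σ' h i t' _
    rw [List.foldlM_nil] at h
    have h : σ' ∈ (PMF.pure σ).support := h
    rw [PMF.support_pure, Set.mem_singleton_iff] at h
    rw [h]
  | cons a l ih =>
    intro σ σ' h i t' hi
    rw [List.foldlM_cons] at h
    change σ' ∈ ((PMF.map _ _).bind _).support at h
    rw [PMF.bind_map, PMF.mem_support_bind_iff] at h
    obtain ⟨v, _, h⟩ := h
    rw [ih _ σ' h i t' (hi.imp_left fun h h' => h (List.mem_cons_of_mem _ h'))]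
    by_cases hia : i = a
    · subst hia
      have : t' ≠ t := hi.resolve_left fun h => h (List.mem_cons_self)
      simp [this]
    · simp [hia]

omit hx in
-- Union bound over users. The list has no duplicates, so no drawn entry is overwritten later.
theorem toOuterMeasure_foldlM_update_le (t : Fin T) (ρ : Fin n → PMF ℝ) (B : Fin n → Set ℝ)
    {b : ENNReal} (hb : ∀ i, (ρ i).toOuterMeasure (B i) ≤ b) (l : List (Fin n)) :
    l.Nodup → ∀ σ : Fin n → Fin T → ℝ, (l.foldlM (fun σ' i => (ρ i).map fun v =>
      Function.update σ' i (Function.update (σ' i) t v)) σ).toOuterMeasure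
        {σ' | ∃ i ∈ l, σ' i t ∈ B i} ≤ l.length * b := by
  induction l with
  | nil => intro _ σ; simp
  | cons a l ih =>
    intro hl σ
    rw [List.nodup_cons] at hl
    rw [List.foldlM_cons]
    change ((PMF.map _ _).bind _).toOuterMeasure _ ≤ _
    rw [PMF.bind_map, List.length_cons, Nat.cast_succ, add_mul, one_mul, add_comm]
    refine (toOuterMeasure_bind_le (B := B a) (c := l.length * b) fun v hv => ?_).trans
      (add_le_add_left (hb a) _)
    refine (PMF.toOuterMeasure_mono _ ?_).trans (ih hl.2 _)
    rintro σ' ⟨⟨i, hi, hB⟩, hs⟩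
    rcases List.mem_cons.1 hi with rfl | hi
    · rw [support_foldlM_update t ρ l _ σ' hs i t (Or.inl hl.1)] at hB
      simp at hB
      exact absurd hB hv
    · exact ⟨i, hi, hB⟩

/-- All estimates for the resources before `k` are accurate up to `δ`. -/
def AccurateBefore (I : Instance n T) (κ : ℝ) (x : Fin n → Fin T → ℝ) (δ : ℝ) (k : ℕ)
    (σ : Fin n → Fin T → ℝ) : Prop :=
  ∀ t : Fin T, t.val < k → ∀ i, |σ i t - simulationMean I κ x σ i t| ≤ δ

omit hx in
theorem AccurateBefore.congr {δ : ℝ} {k : ℕ} {σ σ' : Fin n → Fin T → ℝ}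
    (h : AccurateBefore I κ x δ k σ) (hσ : ∀ i (t : Fin T), t.val < k → σ' i t = σ i t) :
    AccurateBefore I κ x δ k σ' := by
  intro t ht i
  rw [hσ i t ht, simulationMean_congr I κ x σ' i t fun i t' ht' => hσ i t' (lt_trans ht' ht)]
  exact h t ht i

/-- The target mean for a column depends only on earlier columns, so given those the draws have a
fixed mean and a union bound applies. Allowing k < m is what lets part (a) speak about the complete
table. -/
theorem toOuterMeasure_estimates_le {ε δ : ℝ} (hδ₀ : 0 ≤ δ) (hδ : δ ≤ 2)
    (hN : 0 < numSimulations n T ε) {k m : ℕ} (hkm : k ≤ m) (hm : m ≤ T) :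
    (estimatesUpTo I ε x m).toOuterMeasure {σ | ¬AccurateBefore I (kappa ε) x δ k σ} ≤
      k * (n * ENNReal.ofReal (2 * Real.exp (-(numSimulations n T ε * δ ^ 2 / 4)))) := by
  set b := ENNReal.ofReal (2 * Real.exp (-(numSimulations n T ε * δ ^ 2 / 4))) with hb
  induction m generalizing k with
  | zero =>
    obtain rfl : k = 0 := by omega
    simp [AccurateBefore]
  | succ m ih =>
    have hmT : m < T := hm
    set t : Fin T := ⟨m, hmT⟩ with ht
    have hsupp : ∀ σ, ∀ σ' ∈ (drawEstimates I ε x t σ).support, ∀ i t', t' ≠ t →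
        σ' i t' = σ i t' := fun σ σ' h i t' ht' =>
      support_foldlM_update t _ _ σ σ' h i t' (Or.inr ht')
    rw [estimatesUpTo]
    simp only [hmT, dif_pos]
    rcases Nat.lt_or_ge m k with hk | hk
    · obtain rfl : k = m + 1 := by omega
      rw [Nat.cast_succ, add_mul, one_mul]
      refine (toOuterMeasure_bind_le (B := {σ | ¬AccurateBefore I (kappa ε) x δ m σ})
        (c := n * b) fun σ hσ => ?_).trans (add_le_add_left (ih le_rfl (by omega)) _)
      have hσ : AccurateBefore I (kappa ε) x δ m σ := not_not.1 hσ
      have hfold := toOuterMeasure_foldlM_update_le t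
        (fun i => empiricalAverage (simulation I (kappa ε) x σ i t) (numSimulations n T ε))
        (fun i => {v | ¬|v - simulationMean I (kappa ε) x σ i t| ≤ δ}) (b := b)
        (fun i => toOuterMeasure_empiricalAverage_le
          (fun l hl => lexpect_exp_simulation_le hx σ i t hl) hδ₀ hδ hN)
        (List.finRange n) (List.nodup_finRange n) σ
      rw [List.length_finRange] at hfold
      refine (PMF.toOuterMeasure_mono _ ?_).trans hfold
      rintro σ' ⟨hbad, hs⟩
      by_contra hgood
      refine hbad fun t' ht' i => ?_
      have hag : ∀ i (t' : Fin T), t'.val < m → σ' i t' = σ i t' := fun i t' h =>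
        hsupp σ σ' hs i t' fun h' => by rw [h'] at h; exact lt_irrefl _ h
      rcases Nat.lt_succ_iff_lt_or_eq.1 ht' with h | h
      · exact (hσ.congr hag) t' h i
      · have htt : t' = t := Fin.ext h
        rw [htt, simulationMean_congr I (kappa ε) x σ' i t hag]
        by_contra hc
        exact hgood ⟨i, List.mem_finRange i, hc⟩
    -- Column m lies beyond the first k, so drawing it cannot spoil their accuracy: the added
    -- failure probability is 0.
    · rw [← add_zero (k * (n * b))]
      refine (toOuterMeasure_bind_le (B := {σ | ¬AccurateBefore I (kappa ε) x δ k σ})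
        (c := 0) fun σ hσ => ?_).trans (add_le_add_left (ih hk (by omega)) _)
      have hσ : AccurateBefore I (kappa ε) x δ k σ := not_not.1 hσ
      rw [nonpos_iff_eq_zero, PMF.toOuterMeasure_apply_eq_zero_iff, Set.disjoint_left]
      intro σ' hs hbad
      exact hbad (hσ.congr fun i t' h => hsupp σ σ' hs i t' fun h' => by
        rw [h'] at h; exact absurd h (not_lt.2 hk))

end Estimates

/-! ## The LP bounds the optimum online algorithm -/

section Online

variable {n T : ℕ} (I : Instance n T)

/-- The LP for the resources `k, k + 1, …` and the users in `J` attains at least the value of the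
optimum online algorithm. -/
theorem exists_lp_solution_from (k : ℕ) (J : Finset (Fin n)) :
    ∃ x : Fin n → Fin T → ℝ, (∀ i t, 0 ≤ x i t) ∧ (∀ i (t : Fin T), t.val < k → x i t = 0) ∧
      (∀ t, ∑ i, x i t ≤ I.p t * I.c t) ∧
      (∀ i (t : Fin T), k ≤ t.val →
        x i t ≤ I.p t * ((if i ∈ J then 1 else 0) - partialSum x i t)) ∧
      optOnlineFrom I k J = lpValue I x := by
  by_cases hk : k < T
  · obtain ⟨J', hJ', hmax⟩ := Finset.exists_mem_eq_sup'
      (exists_served (I.c ⟨k, hk⟩) J)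
      (fun J' => ∑ i ∈ J', I.v i ⟨k, hk⟩ + optOnlineFrom I (k + 1) (J \ J'))
    obtain ⟨x₀, hn₀, hz₀, hc₀, hp₀, hv₀⟩ := exists_lp_solution_from (k + 1) J
    obtain ⟨x₁, hn₁, hz₁, hc₁, hp₁, hv₁⟩ := exists_lp_solution_from (k + 1) (J \ J')
    rw [Finset.mem_filter, Finset.mem_powerset] at hJ'
    set τ : Fin T := ⟨k, hk⟩ with hτ
    have hp := I.p_nonneg τ
    have hp' := sub_nonneg.2 (I.p_le_one τ)
    -- Mix the solutions for the two futures (no arrival; arrival with J' served) with weights 1 - p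
    -- and p, and give each served user mass p at τ.
    set y : Fin n → Fin T → ℝ := fun i t => (if t = τ ∧ i ∈ J' then I.p τ else 0) +
      ((1 - I.p τ) * x₀ i t + I.p τ * x₁ i t) with hy
    have hyτ : ∀ i, y i τ = I.p τ * if i ∈ J' then 1 else 0 := by
      intro i
      simp [hy, hz₀ i τ (Nat.lt_succ_self k), hz₁ i τ (Nat.lt_succ_self k)]
    have hyne : ∀ i t, t ≠ τ → y i t = (1 - I.p τ) * x₀ i t + I.p τ * x₁ i t := by
      intro i t h
      simp [hy, h]
    refine ⟨y, fun i t => ?_, fun i t ht => ?_, fun t => ?_, fun i t ht => ?_, ?_⟩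
    · have := mul_nonneg hp' (hn₀ i t)
      have := mul_nonneg hp (hn₁ i t)
      simp only [hy]
      split_ifs <;> linarith
    · have hne : t ≠ τ := fun h => by rw [h] at ht; exact lt_irrefl _ ht
      rw [hyne i t hne, hz₀ i t (by omega), hz₁ i t (by omega)]
      ring
    · by_cases h : t = τ
      · subst h
        simp only [hyτ, ← Finset.mul_sum]
        refine mul_le_mul_of_nonneg_left ?_ hp
        simpa using hJ'.2
      · simp only [hyne _ t h, Finset.sum_add_distrib, ← Finset.mul_sum]
        have h0 := mul_le_mul_of_nonneg_left (hc₀ t) hp'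
        have h1 := mul_le_mul_of_nonneg_left (hc₁ t) hp
        linarith
    · have hpart : partialSum y i t = (if τ < t ∧ i ∈ J' then I.p τ else 0) +
          ((1 - I.p τ) * partialSum x₀ i t + I.p τ * partialSum x₁ i t) := by
        simp only [partialSum, hy, Finset.sum_add_distrib, ← Finset.mul_sum]
        congr 1
        by_cases h : i ∈ J' <;> simp [h]
      rcases ht.eq_or_lt with h | h
      · have htt : t = τ := Fin.ext h.symm
        rw [htt] at hpart ⊢
        have hzero : ∀ (x : Fin n → Fin T → ℝ), (∀ i (t' : Fin T), t'.val < k + 1 → x i t' = 0) →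
            partialSum x i τ = 0 := fun x hz =>
          Finset.sum_eq_zero fun t' ht' => hz i t'
            (lt_trans (Fin.lt_def.1 (Finset.mem_Iio.1 ht')) (Nat.lt_succ_self k))
        rw [hpart, hzero x₀ hz₀, hzero x₁ hz₁, hyτ]
        refine mul_le_mul_of_nonneg_left ?_ hp
        by_cases hi : i ∈ J'
        · simp [hi, hJ'.1 hi]
        · simp only [hi, and_false, if_false]
          split_ifs <;> simp
      · have hlt : τ < t := h
        rw [hpart, hyne i t hlt.ne']
        have h0 := mul_le_mul_of_nonneg_left (hp₀ i t h) hp'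
        have h1 := mul_le_mul_of_nonneg_left (hp₁ i t h) hp
        -- A served user has budget 0 in the arrival branch, which pays exactly for its mass p at τ.
        by_cases hi : i ∈ J'
        · simp only [hi, hJ'.1 hi, hlt, and_self, if_true, Finset.mem_sdiff, not_true, and_false,
            if_false] at h0 h1 ⊢
          linarith
        · simp only [hi, and_false, if_false, Finset.mem_sdiff, not_false_eq_true, and_true]
            at h0 h1 ⊢
          linarith
    · rw [optOnlineFrom, dif_pos hk, hmax, hv₀, hv₁]
      have h1 : ∀ i t, y i t * I.v i t = (if t = τ ∧ i ∈ J' then I.p τ else 0) * I.v i t +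
          ((1 - I.p τ) * (x₀ i t * I.v i t) + I.p τ * (x₁ i t * I.v i t)) := by
        intro i t
        simp only [hy]
        ring
      have h2 : ∑ i, ∑ t, (if t = τ ∧ i ∈ J' then I.p τ else 0) * I.v i t =
          I.p τ * ∑ i ∈ J', I.v i τ := by
        have : ∀ i, ∑ t, (if t = τ ∧ i ∈ J' then I.p τ else 0) * I.v i t =
            if i ∈ J' then I.p τ * I.v i τ else 0 := by
          intro i
          rw [Finset.sum_eq_single τ (fun t _ h => by simp [h]) (by simp)]
          simp
        rw [Finset.sum_congr rfl fun i _ => this i, Finset.mul_sum]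
        simp
      simp only [lpValue, h1, Finset.sum_add_distrib, ← Finset.mul_sum, h2]
      ring
  · refine ⟨fun _ _ => 0, by simp, by simp, fun t => ?_, fun i t ht => ?_, ?_⟩
    · simpa using mul_nonneg (I.p_nonneg t) (Nat.cast_nonneg _)
    · exact absurd (ht.trans_lt t.2) hk
    · rw [optOnlineFrom, dif_neg hk]
      simp [lpValue]
termination_by T - k

theorem optOnline_le_lpValue {x : Fin n → Fin T → ℝ} (hx : LPOptimal I x) :
    optOnline I ≤ lpValue I x := by
  obtain ⟨x', hn, _, hc, hp, hv⟩ := exists_lp_solution_from I 0 Finset.univ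
  rw [optOnline, hv]
  exact hx.2 x' ⟨hc, fun i t => ⟨hn i t, by simpa using hp i t (Nat.zero_le _)⟩⟩

end Online

end OnlineAllocation

namespace OnlineAllocation

/-! ## Accurate estimates imply the allocation guarantee -/

section Guarantee

variable {n T : ℕ} {I : Instance n T} {ε : ℝ} {x : Fin n → Fin T → ℝ} (hx : LPFeasible I x)

/-- A numerical lower bound on the quantity that is estimated. -/
theorem simulationMean_numeric {θ y : ℝ} (hθ₀ : 0.5 ≤ θ) (hθ₁ : θ ≤ 0.5115) (hy₁ : y ≤ 1)
    (hy : 1 - θ * y ≤ θ) :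
    0.07 ≤ (1 - 0.5115 * y) * y - θ / (1 + θ * (1 - θ) * y) := by
  norm_num at *
  -- The hypotheses give y ≥ (1 - θ)/θ ≥ 0.4885/0.5115. On [0.955, 1] the concave first term is at
  -- least about 0.488, against at most 0.414 for the second.
  have hy' : (955 / 1000 : ℝ) ≤ y := by nlinarith
  have hc : (2498 / 10000 : ℝ) ≤ θ * (1 - θ) := by nlinarith
  have hK : θ / (1 + θ * (1 - θ) * y) ≤ 414 / 1000 := by
    rw [div_le_iff₀ (by nlinarith)]
    nlinarith [mul_le_mul hc hy' (by norm_num) (by nlinarith)]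
  nlinarith [mul_nonneg (sub_nonneg.2 hy') (sub_nonneg.2 hy₁)]

include hx

theorem abs_allocation_sub_le (hε : 0 < ε) (hε' : ε < 0.0115) (σ : Fin n → Fin T → ℝ) {k : ℕ}
    (hk : k ≤ T) (hσ : AccurateBefore I (kappa ε) x (ε / T) k σ) (t : Fin T) (ht : t.val < k)
    (i : Fin n) :
    |firstProb I (kappa ε) x σ i t + secondProb I (kappa ε) x σ i t -
      (0.5 + kappa ε) * x i t| ≤ ε * ((t : ℝ) + 1) / T * x i t := by
  have hT : (0 : ℝ) < T := by exact_mod_cast t.pos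
  have hT1 : (1 : ℝ) ≤ T := by exact_mod_cast t.pos
  have hκ₀ : 0 < kappa ε := sub_pos.2 hε'
  have hκ₁ : kappa ε ≤ 0.0115 := sub_le_self _ hε.le
  set y := partialSum x i t with hy
  set θ := 0.5 + kappa ε with hθ
  have hθε : θ + ε = 0.5115 := by rw [hθ, kappa]; norm_num; ring
  have hy0 : 0 ≤ y := hx.partialSum_nonneg i t
  have hy1 : y ≤ 1 := hx.partialSum_le_one i t
  have hxit := (hx.2 i t).1
  -- Being free is the complement of earlier allocation, so the recursive bounds for t' < t add up.
  -- Keeping the factor y turns 1 - θy - εy into 1 - 0.5115 y below.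
  have hfree : |freeProb I (kappa ε) x σ t.val i - (1 - θ * y)| ≤ ε * t / T * y := by
    rw [freeProb_eq I (kappa ε) x σ i t.2.le]
    have : 1 - prefixSum (fun i t => firstProb I (kappa ε) x σ i t +
        secondProb I (kappa ε) x σ i t) i t.val - (1 - θ * y) =
        ∑ t' ∈ Finset.univ.filter fun t' : Fin T => t'.val < t.val,
          -(firstProb I (kappa ε) x σ i t' + secondProb I (kappa ε) x σ i t' - θ * x i t') := by
      rw [hy, partialSum_eq_prefixSum, Finset.sum_neg_distrib, Finset.sum_sub_distrib,
        ← Finset.mul_sum]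
      simp only [prefixSum]
      ring
    rw [this, hy, partialSum_eq_prefixSum, prefixSum, Finset.mul_sum]
    refine (Finset.abs_sum_le_sum_abs _ _).trans (Finset.sum_le_sum fun t' ht' => ?_)
    have ht'' : t'.val < t.val := (Finset.mem_filter.1 ht').2
    rw [abs_neg]
    refine (abs_allocation_sub_le hε hε' σ hk hσ t' (ht''.trans ht) i).trans ?_
    refine mul_le_mul_of_nonneg_right ?_ (hx.2 i t').1
    have : (t' : ℝ) + 1 ≤ t := by exact_mod_cast ht''
    gcongr
  have herr : ε * t / T * y ≤ ε * t / T := mul_le_of_le_one_right (by positivity) hy1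
  have hsplit : ε * ((t : ℝ) + 1) / T = ε * t / T + ε / T := by ring
  have hδ : 0 < ε / T := by positivity
  rw [firstProb_eq σ hx hκ₀ hκ₁, secondProb_eq σ hx]
  by_cases hα : alpha (kappa ε) x i t = 1
  · rw [if_pos hα, hα, one_mul]
    have hle := (alpha_eq_one_iff hκ₀ hκ₁ hy1).1 hα
    rw [← hθ, ← hy] at hle
    set m := simulationMean I (kappa ε) x σ i t with hm
    have htT : ε * t / T ≤ ε := by
      rw [div_le_iff₀ hT]
      exact mul_le_mul_of_nonneg_left (by exact_mod_cast t.2.le) hε.le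
    have hfree' : 1 - 0.5115 * y ≤ freeProb I (kappa ε) x σ t.val i := by
      have h1 := (abs_le.1 hfree).1
      have h2 := mul_le_mul_of_nonneg_right htT hy0
      rw [← hθε]
      linarith
    have hm0 : 0.07 ≤ m := by
      refine (simulationMean_numeric (θ := θ) ?_ ?_ hy1 hle).trans
        (le_trans ?_ (le_simulationMean σ hx hκ₀ hκ₁ i t hα))
      · rw [hθ]; linarith
      · linarith
      · exact sub_le_sub_right (mul_le_mul_of_nonneg_right hfree' hy0) _
    have hacc := abs_le.1 (hσ t ht i)
    rw [← hm] at hacc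
    have hδε : ε / T ≤ ε := div_le_self hε.le hT1
    set a := θ * y - (0.5 - kappa ε) with ha
    have ha0 : 0 ≤ a := by rw [ha]; rw [hθ] at hle ⊢; norm_num at *; linarith
    -- From y ≤ 1 one gets a ≤ 2κ ≤ 2 · 0.0115.
    have ha1 : a ≤ 0.023 := by
      have h1 : θ * y ≤ θ := mul_le_of_le_one_right (by rw [hθ]; positivity) hy1
      rw [ha]; rw [hθ] at h1 ⊢; norm_num at *; linarith
    -- The estimate is at least 0.07 - ε/T > 0.07 - 0.0115. Hence a/σ ≤ 1, and the cap in `betaHat`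
    -- is inactive.
    have hσ0 : 0.05 ≤ σ i t := by norm_num at *; linarith
    have hσpos : 0 < σ i t := lt_of_lt_of_le (by norm_num) hσ0
    have hβ : clamp (betaHat (kappa ε) x i t (σ i t)) = a / σ i t := by
      have hb : a / σ i t ≤ 1 := (div_le_one hσpos).2 (by norm_num at *; linarith)
      simp only [betaHat]
      rw [← hθ, ← hy, ← ha, if_neg fun h => hσpos.ne' h.1, min_eq_right hb]
      exact clamp_of_mem (by positivity) hb
    rw [hβ]
    have hsecond : |m * (a / σ i t) - a| ≤ ε / T := by
      have : m * (a / σ i t) - a = a / σ i t * (m - σ i t) := by field_simp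
      rw [this, abs_mul, abs_of_nonneg (by positivity), abs_sub_comm]
      refine (mul_le_of_le_one_left (abs_nonneg _) ?_).trans (hσ t ht i)
      exact (div_le_one hσpos).2 (by norm_num at *; linarith)
    -- The two target values match: (1 - θy) + a = 0.5 + κ.
    have hrw : x i t * freeProb I (kappa ε) x σ t.val i + x i t * (m * (a / σ i t)) - θ * x i t =
        x i t * ((freeProb I (kappa ε) x σ t.val i - (1 - θ * y)) + (m * (a / σ i t) - a)) := by
      rw [ha, hθ]; norm_num; ring
    rw [hrw, abs_mul, abs_of_nonneg hxit, mul_comm, hsplit]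
    exact mul_le_mul_of_nonneg_right
      ((abs_add_le _ _).trans (add_le_add (hfree.trans herr) hsecond)) hxit
  · have hpos := one_sub_mul_partialSum_pos hκ₀ hκ₁ hy1
    have hα' := alpha_of_ne_one hα
    have hα0 := alpha_pos (x := x) (i := i) (t := t) hκ₀ hκ₁ hy1
    have hmul : alpha (kappa ε) x i t * (1 - θ * y) = θ := by
      rw [hα']
      exact div_mul_cancel₀ _ hpos.ne'
    have hrw : x i t * (alpha (kappa ε) x i t * freeProb I (kappa ε) x σ t.val i) + 0 -
        θ * x i t = (x i t * alpha (kappa ε) x i t) *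
          (freeProb I (kappa ε) x σ t.val i - (1 - θ * y)) := by
      linear_combination (x i t) * hmul
    rw [if_neg hα, hrw, abs_mul, abs_of_nonneg (by positivity), mul_comm, hsplit]
    refine mul_le_mul (by linarith [hfree]) ?_ (by positivity) (by positivity)
    exact mul_le_of_le_one_right hxit (alpha_le_one _ _ _ _)
termination_by t.val

omit hx in
theorem le_numSimulations (hε : 0 < ε) (hε' : ε < 0.0115) (hn : 0 < n) (hT : 0 < T) :
    (100 * n * T : ℝ) ≤ numSimulations n T ε * (ε / T) ^ 2 / 4 := by
  have hn' : (0 : ℝ) < n := by exact_mod_cast hn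
  have hT' : (0 : ℝ) < T := by exact_mod_cast hT
  have hκ₀ : 0 < kappa ε := sub_pos.2 hε'
  have hκ₁ : kappa ε ≤ 1 := by rw [kappa]; norm_num at *; linarith
  have h := Nat.le_ceil (50 * n * T * ((ε / (400 * T)) ^ 2)⁻¹ * (kappa ε ^ 2)⁻¹)
  have h1 : 1 ≤ (kappa ε ^ 2)⁻¹ := (one_le_inv₀ (by positivity)).2 (pow_le_one₀ hκ₀.le hκ₁)
  have h2 : 50 * n * T * ((ε / (400 * T)) ^ 2)⁻¹ ≤ (numSimulations n T ε : ℝ) :=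
    (le_mul_of_one_le_right (by positivity) h1).trans h
  have h3 := mul_le_mul_of_nonneg_right h2 (sq_nonneg (ε / T))
  -- Here 50 · 400² = 8000000, far more than the 400 needed; of κ⁻² only κ⁻² ≥ 1 is used.
  have h4 : 50 * n * T * ((ε / (400 * T)) ^ 2)⁻¹ * (ε / T) ^ 2 = 8000000 * (n * T) := by
    field_simp
    norm_num
  rw [h4] at h3
  have : (0 : ℝ) < n * T := by positivity
  linarith

theorem one_sub_le_prob_accurateBefore (hε : 0 < ε) (hε' : ε < 0.0115) {k : ℕ} (hk : k ≤ T) :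
    1 - 2 * n * k * Real.exp (-100 * n * T) ≤
      prob (estimates I ε x) {σ | AccurateBefore I (kappa ε) x (ε / T) k σ} := by
  have hcompl := toOuterMeasure_add_compl (estimates I ε x)
    {σ | AccurateBefore I (kappa ε) x (ε / T) k σ}
  have hreal := congrArg ENNReal.toReal hcompl
  have hfin : ∀ S, (estimates I ε x).toOuterMeasure S ≠ ⊤ := fun S =>
    ne_top_of_le_ne_top ENNReal.one_ne_top (toOuterMeasure_le_one _ _)
  rw [ENNReal.toReal_add (hfin _) (hfin _), ENNReal.toReal_one] at hreal
  have hbad : ((estimates I ε x).toOuterMeasure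
      {σ | AccurateBefore I (kappa ε) x (ε / T) k σ}ᶜ).toReal ≤
      2 * n * k * Real.exp (-100 * n * T) := by
    refine ENNReal.toReal_le_of_le_ofReal (by positivity) ?_
    rcases Nat.eq_zero_or_pos (n * T) with h0 | h0
    -- Without users or resources the number of simulations may be 0, but then there is no estimate
    -- to be wrong.
    · have hall : {σ | AccurateBefore I (kappa ε) x (ε / T) k σ} = Set.univ := by
        refine Set.eq_univ_of_forall fun σ t _ i => ?_
        exact absurd h0 (Nat.mul_pos i.pos t.pos).ne'
      rw [hall]
      simp
    · have hn : 0 < n := Nat.pos_of_mul_pos_right h0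
      have hT : 0 < T := Nat.pos_of_mul_pos_left h0
      have hT1 : (1 : ℝ) ≤ T := by exact_mod_cast hT
      have hle := le_numSimulations hε hε' hn hT
      have hN : 0 < numSimulations n T ε := by
        rw [Nat.pos_iff_ne_zero]
        intro h
        rw [h, Nat.cast_zero, zero_mul, zero_div] at hle
        have : (0 : ℝ) < 100 * n * T := by positivity
        linarith
      have hδ : ε / T ≤ 2 := (div_le_self hε.le hT1).trans (by norm_num at *; linarith)
      refine (toOuterMeasure_estimates_le hx (by positivity) hδ hN hk le_rfl).trans ?_
      rw [← ENNReal.ofReal_natCast, ← ENNReal.ofReal_natCast, ← ENNReal.ofReal_mul (by positivity),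
        ← ENNReal.ofReal_mul (by positivity)]
      refine ENNReal.ofReal_le_ofReal ?_
      have hexp : Real.exp (-(numSimulations n T ε * (ε / T) ^ 2 / 4)) ≤
          Real.exp (-100 * n * T) := Real.exp_le_exp.2 (by linarith)
      have := mul_le_mul_of_nonneg_left hexp (by positivity : (0 : ℝ) ≤ 2 * n * k)
      linarith
  unfold prob
  linarith

omit hx in
theorem prob_mono {α : Type} (μ : PMF α) {S S' : Set α} (h : S ⊆ S') : prob μ S ≤ prob μ S' :=
  ENNReal.toReal_mono (ne_top_of_le_ne_top ENNReal.one_ne_top (toOuterMeasure_le_one _ _))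
    (MeasureTheory.measure_mono h)

theorem lpValue_le_expectedWelfare (hε : 0 < ε) (hε' : ε < 0.0115) {σ : Fin n → Fin T → ℝ}
    (hσ : AccurateBefore I (kappa ε) x (ε / T) T σ) :
    (0.5115 - 2 * ε) * lpValue I x ≤ expectedWelfare I ε x σ := by
  rw [expectedWelfare, expect_welfare, lpValue, Finset.mul_sum]
  refine Finset.sum_le_sum fun i _ => ?_
  rw [Finset.mul_sum]
  refine Finset.sum_le_sum fun t _ => ?_
  rw [← mul_assoc]
  refine mul_le_mul_of_nonneg_right ?_ (I.v_nonneg i t)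
  have h := (abs_le.1 (abs_allocation_sub_le hx hε hε' σ le_rfl hσ t t.2 i)).1
  have hT : (0 : ℝ) < T := by exact_mod_cast t.pos
  have hle : ε * ((t : ℝ) + 1) / T ≤ ε := by
    rw [div_le_iff₀ hT]
    exact mul_le_mul_of_nonneg_left (by exact_mod_cast t.2) hε.le
  have h2 := mul_le_mul_of_nonneg_right hle (hx.2 i t).1
  have h3 : (0.5115 - 2 * ε) * x i t = (0.5 + kappa ε) * x i t - ε * x i t := by
    rw [kappa]; norm_num; ring
  rw [h3]
  linarith

end Guarantee

end OnlineAllocation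

end

/-! ### The main theorem -/

theorem mainTheorem6 {n T : ℕ} (I : OnlineAllocation.Instance n T) (ε : ℝ) (hε : 0 < ε)
    (hε' : ε < 0.0115) (x : Fin n → Fin T → ℝ) (hx : OnlineAllocation.LPOptimal I x) :
    (∀ t : Fin T,
      1 - 2 * n * ((t : ℝ) + 1) * Real.exp (-100 * n * T) ≤
        OnlineAllocation.prob (OnlineAllocation.estimates I ε x)
          {σ | ∀ t' ≤ t, ∀ i : Fin n,
            OnlineAllocation.allocProb I ε x σ i t' ∈
              Set.Icc
                ((0.5 + OnlineAllocation.kappa ε - ε * ((t' : ℝ) + 1) / T) * x i t')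
                ((0.5 + OnlineAllocation.kappa ε + ε * ((t' : ℝ) + 1) / T) * x i t')}) ∧
    1 - 2 * n * T * Real.exp (-100 * n * T) ≤
      OnlineAllocation.prob (OnlineAllocation.estimates I ε x)
        {σ | (0.5115 - 2 * ε) * OnlineAllocation.lpValue I x ≤
              OnlineAllocation.expectedWelfare I ε x σ ∧
            (0.5115 - 2 * ε) * OnlineAllocation.optOnline I ≤
              OnlineAllocation.expectedWelfare I ε x σ} := by
  have hxf := hx.1
  have haccurate : ∀ {σ : Fin n → Fin T → ℝ} {k : ℕ}, k ≤ T →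
      OnlineAllocation.AccurateBefore I (OnlineAllocation.kappa ε) x (ε / T) k σ →
      ∀ t : Fin T, t.val < k → ∀ i : Fin n, OnlineAllocation.allocProb I ε x σ i t ∈ Set.Icc
        ((0.5 + OnlineAllocation.kappa ε - ε * ((t : ℝ) + 1) / T) * x i t)
        ((0.5 + OnlineAllocation.kappa ε + ε * ((t : ℝ) + 1) / T) * x i t) := by
    intro σ k hk hσ t ht i
    have h := abs_le.1 (OnlineAllocation.abs_allocation_sub_le hxf hε hε' σ hk hσ t ht i)
    rw [OnlineAllocation.allocProb, OnlineAllocation.prob_run_fst, OnlineAllocation.prob_run_snd]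
    constructor <;> linarith
  constructor
  · intro t
    -- Resources are counted from 0, so those up to t are the ones before k = t + 1.
    have h := OnlineAllocation.one_sub_le_prob_accurateBefore hxf hε hε' (Nat.succ_le_of_lt t.2)
    rw [Nat.succ_eq_add_one, Nat.cast_add, Nat.cast_one] at h
    refine h.trans (OnlineAllocation.prob_mono _ fun σ hσ t' ht' i => ?_)
    exact haccurate (Nat.succ_le_of_lt t.2) hσ t' (Nat.lt_succ_of_le ht') i
  · refine (OnlineAllocation.one_sub_le_prob_accurateBefore hxf hε hε' le_rfl).trans
      (OnlineAllocation.prob_mono _ fun σ hσ => ?_)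
    have h := OnlineAllocation.lpValue_le_expectedWelfare hxf hε hε' hσ
    refine ⟨h, (mul_le_mul_of_nonneg_left (OnlineAllocation.optOnline_le_lpValue I hx) ?_).trans h⟩
    norm_num at *
    linarith
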